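/- Let $d\ge 1$. A $d$-dimensional 0-1 matrix of dimensions $k_1\times\dots\times k_d$ (positive integers) is an array of $0$s and $1$s indexed by $[k_1]\times\dots\times[k_d]$. A $d$-dimensional 0-1 matrix $A$ contains a $d$-dimensional 0-1 matrix $Q$ if $A$ has a submatrix, obtained by selecting some of the coordinates in each dimension, that can be turned into $Q$ by changing any number of $1$-entries to $0$-entries; $A$ properly contains $Q$ if moreover $Q\ne A$. Let $\operatorname{ex}(n,Q,d)$ be the maximum number of $1$-entries in a $d$-dimensional $n\times\dots\times n$ 0-1 matrix that does not contain $Q$ (and $0$ if there is no such matrix). A $d$-dimensional 0-1 matrix $M$ is called minimally non-$O(n^{d-1})$ if $\operatorname{ex}(n,M,d)=\omega(n^{d-1})$, i.e. $\operatorname{ex}(n,M,d)/n^{d-1}\to\infty$ as $n\to\infty$, but $\operatorname{ex}(n,M',d)=O(n^{d-1})$ for every $d$-dimensional 0-1 matrix $M'$ properly contained in $M$. Theorem. Let $k_1,\dots,k_{d-1}$ be positive integers, and let $$S=1+2\sum_{i=1}^{d-1}(2k_i-2),\qquad P=\prod_{i=1}^{d-1}k_i .$$ Then there are only finitely many minimally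 non-$O(n^{d-1})$ $d$-dimensional 0-1 matrices whose first $d-1$ dimensions are $k_1\times k_2\times\dots\times k_{d-1}$ (the last dimension being arbitrary), and their number is at most $$\sum_{j=1}^{S}\bigl((j+1)^{P}-j^{P}\bigr)P^{\,j-1}.$$ -/

import Mathlib

/-- A `d`-dimensional 0-1 matrix of dimensions `side 0 × ⋯ × side (d - 1)`, all of them positive.
The value `true` stands for a `1`-entry and `false` for a `0`-entry. -/
structure ZeroOneMatrix (d : ℕ) where
  side : Fin d → ℕ
  side_pos : ∀ i, 0 < side i
  entry : (∀ i, Fin (side i)) → Bool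

namespace ZeroOneMatrix

/-- The number of `1`-entries. -/
def weight {d : ℕ} (A : ZeroOneMatrix d) : ℕ :=
  (Finset.univ.filter fun x : (∀ i, Fin (A.side i)) => A.entry x = true).card

/-- `A` contains `P`: some submatrix of `A` (obtained by selecting, in each dimension `i`,
`P.side i` of the coordinates in increasing order) has a `1`-entry wherever `P` has one, so it turns
into `P` by changing some `1`-entries to `0`-entries. -/
def Contains {d : ℕ} (A P : ZeroOneMatrix d) : Prop :=
  ∃ f : ∀ i, Fin (P.side i) ↪o Fin (A.side i),
    ∀ x : (∀ i, Fin (P.side i)), P.entry x = true → A.entry (fun i => f i (x i)) = true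

/-- The weights of the `P`-free `d`-dimensional 0-1 matrices of dimensions `n × ⋯ × n`. -/
def freeWeights {d : ℕ} (n : ℕ) (P : ZeroOneMatrix d) : Set ℕ :=
  {w | ∃ A : ZeroOneMatrix d, (∀ i, A.side i = n) ∧ ¬ A.Contains P ∧ A.weight = w}

/-- The supremum in the definition of `ex` is over a bounded set of natural numbers, so it is a
maximum whenever there is a `P`-free matrix at all (and it is `0` otherwise). -/
theorem bddAbove_freeWeights {d : ℕ} (n : ℕ) (P : ZeroOneMatrix d) :
    BddAbove (freeWeights n P) := by
  refine ⟨n ^ d, ?_⟩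
  rintro w ⟨A, hA, -, rfl⟩
  refine (Finset.card_filter_le _ _).trans (le_of_eq ?_)
  simp [hA]

/-- The extremal function `ex(n, P, d)`: the maximum number of `1`-entries in a `P`-free
`d`-dimensional 0-1 matrix of dimensions `n × ⋯ × n`. -/
noncomputable def ex {d : ℕ} (n : ℕ) (P : ZeroOneMatrix d) : ℕ :=
  sSup (freeWeights n P)

/-- `P` is minimally non-`O(n^(d-1))`: `ex(n, P, d) = ω(n^(d-1))`, while
`ex(n, Q, d) = O(n^(d-1))` for every `Q` properly contained in `P`. -/
def IsMinimallyNonO {d : ℕ} (P : ZeroOneMatrix d) : Prop :=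
  ((fun n : ℕ => (n : ℝ) ^ (d - 1)) =o[Filter.atTop] fun n : ℕ => (ex n P : ℝ)) ∧
    ∀ Q : ZeroOneMatrix d, P.Contains Q → Q ≠ P →
      (fun n : ℕ => (ex n Q : ℝ)) =O[Filter.atTop] fun n : ℕ => (n : ℝ) ^ (d - 1)

end ZeroOneMatrix

/-! A line consists of the positions that agree in all but the last coordinate, a layer of those
with a fixed last coordinate. Two planar patterns on two rows have superlinear extremal functions:
the alternation `a b a b`, by the recursive construction behind `exists_dead_card_le`, and two ones
in a common column that both have an earlier one in their row, by Füredi's matrix. If four ones of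
`M` project to such a pattern in some dimension and the last one, they alone make `M` superlinear,
so a minimal `M` has no other ones.

Bounding the layers (`side_last_le`): no layer of a minimal matrix is empty, and a single one in a
layer cannot sit between two neighbours on its line, nor end the matrix right after a neighbour
(`not_between`, `not_last`). Choose a one in each layer, leaving the previous line whenever
possible. Each stay on a line is then followed by a change of line, and without alternations the
`i`-th coordinate changes at most `2 * k i - 2` times. This yields at most `S` layers.

Counting (`mem_image_decode`): outside the Füredi case each layer has at most one one that is not
the first of its line. Hence `M` is determined by the first position on each of the `P` lines and
one line for each layer but the first. The exceptional matrices receive codes that no other minimal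
matrix needs. -/

/-! ### Alternation-free matrices and their block diagonal copies. -/

/-- A 0-1 matrix with linearly ordered rows `R` and columns `C`, every row of which has at least `k`
ones and begins in its `home` column.  The homes lie in `live` columns, `m` in each of them, and the
other ones lie in `dead` columns.  The matrix avoids the alternation `a b a b` of rows `a < b`, and
rows `a < b` with a common home even avoid `a b` after this home. -/
structure AlternationFree (k m : ℕ) (R C : Type) [LinearOrder R] [LinearOrder C] where
  live : Finset C
  dead : Finset C
  supp : R → Finset C
  home : R → C
  home_live : ∀ r, home r ∈ live
  home_supp : ∀ r, home r ∈ supp r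
  home_le : ∀ r, ∀ c ∈ supp r, home r ≤ c
  eq_home : ∀ r, ∀ c ∈ supp r, c ∈ live → c = home r
  supp_sub : ∀ r, ∀ c ∈ supp r, c ∈ live ∨ c ∈ dead
  card_home : ∀ c ∈ live, Nat.card {r // home r = c} = m
  le_card : ∀ r, k ≤ (supp r).card
  avoid : ∀ a b, a < b → ∀ c₁ ∈ supp a, ∀ c₂ ∈ supp b, ∀ c₃ ∈ supp a, ∀ c₄ ∈ supp b,
    c₁ < c₂ → c₂ < c₃ → ¬ c₃ < c₄
  -- This strengthening makes `substitute` work: rows with a common home receive new ones in front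
  -- of it, in decreasing order, and may then begin with `b a`, which leaves only `a b` to be
  -- excluded later.
  avoid_home : ∀ a b, a < b → home a = home b → ∀ c₃ ∈ supp a, ∀ c₄ ∈ supp b,
    home a < c₃ → ¬ c₃ < c₄

namespace AlternationFree

/-- A single live column. -/
def single (k m : ℕ) (h : k = 0 ∨ m = 0) : AlternationFree k m (Fin m) Unit where
  live := Finset.univ
  dead := ∅
  supp _ := Finset.univ
  home _ := ()
  home_live := by simp
  home_supp := by simp
  home_le := by simp
  eq_home := by simp
  supp_sub := by simp
  card_home := by simp
  le_card r := by
    rcases h with rfl | rfl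
    · simp
    · exact r.elim0
  avoid := by simp
  avoid_home := by simp

section Copies

variable {k m : ℕ} {R C : Type} [LinearOrder R] [LinearOrder C]

/-- The block diagonal matrix of `q` copies of a matrix. -/
def copies (A : AlternationFree k m R C) (q : ℕ) :
    AlternationFree k m (Fin q ×ₗ R) (Fin q ×ₗ C) where
  live := (Finset.univ ×ˢ A.live).map toLex.toEmbedding
  dead := (Finset.univ ×ˢ A.dead).map toLex.toEmbedding
  supp r := ({(ofLex r).1} ×ˢ A.supp (ofLex r).2).map toLex.toEmbedding
  home r := toLex ((ofLex r).1, A.home (ofLex r).2)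
  home_live r := by simp [A.home_live]
  home_supp r := by simp [A.home_supp]
  home_le r c hc := by
    simp only [Finset.mem_map_equiv, Finset.mem_product, Finset.mem_singleton] at hc
    rw [Prod.Lex.le_iff]
    exact Or.inr ⟨hc.1.symm, A.home_le _ _ hc.2⟩
  eq_home r c hc hl := by
    simp only [Finset.mem_map_equiv, Finset.mem_product, Finset.mem_singleton] at hc hl
    apply ofLex.injective
    exact Prod.ext hc.1 (A.eq_home _ _ hc.2 hl.2)
  supp_sub r c hc := by
    simp only [Finset.mem_map_equiv, Finset.mem_product, Finset.mem_singleton,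
      Finset.mem_univ, true_and] at hc ⊢
    exact A.supp_sub _ _ hc.2
  card_home c hc := by
    simp only [Finset.mem_map_equiv, Finset.mem_product, Finset.mem_univ, true_and] at hc
    refine Eq.trans ?_ (A.card_home _ hc)
    refine Nat.card_congr
      { toFun := fun r => ⟨(ofLex r.1).2, ?_⟩
        invFun := fun r => ⟨toLex ((ofLex c).1, r.1), ?_⟩
        left_inv := ?_
        right_inv := ?_ }
    · exact congrArg (fun x => (ofLex x).2) r.2
    · have := r.2
      apply ofLex.injective
      exact Prod.ext rfl this
    · rintro ⟨r, rfl⟩; rfl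
    · rintro ⟨r, h⟩; rfl
  le_card r := by simpa using A.le_card (ofLex r).2
  avoid a b hab c₁ h₁ c₂ h₂ c₃ h₃ c₄ h₄ l₁ l₂ l₃ := by
    simp only [Finset.mem_map_equiv, Finset.mem_product, Finset.mem_singleton,
      toLex_symm_eq] at h₁ h₂ h₃ h₄
    rw [Prod.Lex.lt_iff] at hab l₁ l₂ l₃
    rw [h₁.1, h₂.1] at l₁
    rw [h₂.1, h₃.1] at l₂
    rw [h₃.1, h₄.1] at l₃
    have h : (ofLex a).1 = (ofLex b).1 := by
      rcases hab with h | h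
      · rcases l₂ with l | l
        · exact absurd h l.asymm
        · exact l.1.symm
      · exact h.1
    simp only [h, lt_irrefl, false_or, true_and] at hab l₁ l₂ l₃
    exact A.avoid _ _ hab _ h₁.2 _ h₂.2 _ h₃.2 _ h₄.2 l₁ l₂ l₃
  avoid_home a b hab hh c₃ h₃ c₄ h₄ l₂ l₃ := by
    simp only [Finset.mem_map_equiv, Finset.mem_product, Finset.mem_singleton,
      toLex_symm_eq] at h₃ h₄
    rw [toLex_inj, Prod.mk.injEq] at hh
    rw [Prod.Lex.lt_iff] at hab l₂ l₃
    rw [h₃.1, h₄.1] at l₃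
    rw [h₃.1] at l₂
    simp only [hh.1, lt_irrefl, false_or, true_and, ofLex_toLex] at hab l₂ l₃
    exact A.avoid_home _ _ hab hh.2 _ h₃.2 _ h₄.2 l₂ l₃

theorem card_live_copies (A : AlternationFree k m R C) (q : ℕ) :
    (A.copies q).live.card = q * A.live.card := by
  simp [copies]

theorem card_dead_copies (A : AlternationFree k m R C) (q : ℕ) :
    (A.copies q).dead.card = q * A.dead.card := by
  simp [copies]

end Copies

end AlternationFree

/-! ### Substituting one alternation-free matrix into another. -/

theorem exists_strictAntiOn_bijOn {α β : Type*} [LinearOrder α] [LinearOrder β] [Inhabited β]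
    (s : Finset α) (t : Finset β) (h : s.card = t.card) :
    ∃ g : α → β, Set.BijOn g s t ∧ StrictAntiOn g s := by
  classical
  let e := s.orderIsoOfFin h
  let e' := t.orderIsoOfFin rfl
  let g : α → β := fun a => if ha : a ∈ s then (e' (e.symm ⟨a, ha⟩).rev : β) else default
  have hg : ∀ a (ha : a ∈ s), g a = e' (e.symm ⟨a, ha⟩).rev := fun a ha => by simp [g, ha]
  have hanti : StrictAntiOn g s := by
    intro a ha b hb hab
    rw [hg a ha, hg b hb]
    have : e.symm ⟨a, ha⟩ < e.symm ⟨b, hb⟩ := e.symm.strictMono hab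
    have := e'.strictMono (Fin.rev_lt_rev.2 this)
    exact this
  have hmaps : Set.MapsTo g s t := by
    intro a ha
    rw [hg a ha]
    exact Subtype.prop _
  refine ⟨g, ⟨hmaps, hanti.injOn, ?_⟩, hanti⟩
  exact Finset.surjOn_of_injOn_of_card_le g hmaps hanti.injOn h.ge

namespace AlternationFree

section Columns

variable {C C' : Type}

/-- The column `c` itself, behind the copy that is put in front of it. -/
def behind : C ↪ C ×ₗ WithTop C' where
  toFun c := toLex (c, ⊤)
  inj' a b h := by simpa using h

/-- The copy in front of the column `c`. -/
def front (c : C) : C' ↪ C ×ₗ WithTop C' where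
  toFun j := toLex (c, (j : WithTop C'))
  inj' a b h := by simpa using h

theorem mem_map_behind {s : Finset C} {x : C ×ₗ WithTop C'} :
    x ∈ s.map behind ↔ (ofLex x).1 ∈ s ∧ (ofLex x).2 = ⊤ := by
  simp only [Finset.mem_map, behind]
  constructor
  · rintro ⟨c, hc, rfl⟩; exact ⟨hc, rfl⟩
  · rintro ⟨h, h'⟩
    exact ⟨_, h, ofLex.injective (Prod.ext rfl h'.symm)⟩

theorem mem_map_front {s : Finset C'} {c : C} {x : C ×ₗ WithTop C'} :
    x ∈ s.map (front c) ↔ (ofLex x).1 = c ∧ ∃ j ∈ s, (ofLex x).2 = (j : WithTop C') := by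
  simp only [Finset.mem_map, front]
  constructor
  · rintro ⟨j, hj, rfl⟩; exact ⟨rfl, j, hj, rfl⟩
  · rintro ⟨rfl, j, hj, h⟩
    exact ⟨j, hj, ofLex.injective (Prod.ext rfl h.symm)⟩

theorem pairwiseDisjoint_map_front (s : Finset C) (t : Finset C') :
    (s : Set C).PairwiseDisjoint fun c => t.map (front c) := by
  intro c _ c' _ h
  simp only [Function.onFun]
  rw [Finset.disjoint_left]
  intro x hx hx'
  rw [mem_map_front] at hx hx'
  exact h (hx.1.symm.trans hx'.1)

theorem mem_insert_behind [LinearOrder C] [LinearOrder C'] {s : Finset C} {y x : C ×ₗ WithTop C'}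
    (h : x ∈ insert y (s.map behind)) (hy : (ofLex y).1 ∈ s) :
    (ofLex x).1 ∈ s ∧ ((ofLex x).2 = ⊤ ∨ (ofLex x).1 = (ofLex y).1 ∧
      (ofLex x).2 = (ofLex y).2) := by
  rw [Finset.mem_insert, mem_map_behind] at h
  rcases h with rfl | h
  · exact ⟨hy, Or.inr ⟨rfl, rfl⟩⟩
  · exact ⟨h.1, Or.inl h.2⟩

end Columns

section Substitute

variable {k m : ℕ} {R C R' C' : Type} [LinearOrder R] [LinearOrder C] [LinearOrder R']
  [LinearOrder C'] [Finite R']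

/-- Given `g` which distributes the rows of `A` with a common home over the live columns of `B`, the
matrix obtained from `A` by putting a copy of `B` in front of each live column `c`, and a new one of
each row with home `c` into this copy. -/
def substitute [Inhabited C'] (B : AlternationFree (k + 1) m R' C')
    (A : AlternationFree k B.live.card R C) (g : R → C')
    (hmem : ∀ s, g s ∈ B.live)
    (hanti : ∀ s s', s < s' → A.home s = A.home s' → g s' < g s)
    (hsurj : ∀ c ∈ A.live, ∀ j ∈ B.live, ∃ s, A.home s = c ∧ g s = j) :
    AlternationFree (k + 1) (m + 1) (R ⊕ₗ ({c // c ∈ A.live} ×ₗ R')) (C ×ₗ WithTop C') where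
  live := A.live.disjiUnion (fun c => B.live.map (front c)) (pairwiseDisjoint_map_front _ _)
  dead := (A.live.biUnion (fun c => B.dead.map (front c))) ∪ (A.live ∪ A.dead).map behind
  supp r := Sum.elim (fun s => insert (toLex (A.home s, (g s : WithTop C'))) ((A.supp s).map behind))
    (fun p => (B.supp (ofLex p).2).map (front (ofLex p).1.1)) (ofLex r)
  home r := Sum.elim (fun s => toLex (A.home s, (g s : WithTop C')))
    (fun p => toLex ((ofLex p).1.1, ((B.home (ofLex p).2 : C') : WithTop C'))) (ofLex r)
  home_live r := by
    rcases r with s | p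
    · simp only [Finset.mem_disjiUnion, mem_map_front]
      exact ⟨_, A.home_live s, rfl, _, hmem s, rfl⟩
    · simp only [Finset.mem_disjiUnion, mem_map_front]
      exact ⟨_, (ofLex p).1.2, rfl, _, B.home_live _, rfl⟩
  home_supp r := by
    rcases r with s | p
    · exact Finset.mem_insert_self _ _
    · exact mem_map_front.2 ⟨rfl, _, B.home_supp _, rfl⟩
  home_le r c hc := by
    rcases r with s | p
    · obtain ⟨h, h'⟩ := mem_insert_behind hc (A.home_supp s)
      refine Prod.Lex.le_iff.2 ?_
      rcases (A.home_le s _ h).lt_or_eq with hl | hl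
      · exact Or.inl hl
      · refine Or.inr ⟨hl, ?_⟩
        rcases h' with h' | h'
        · rw [h']; exact le_top
        · rw [h'.2]; rfl
    · obtain ⟨h, j, hj, h'⟩ := mem_map_front.1 hc
      refine Prod.Lex.le_iff.2 (Or.inr ⟨h.symm, ?_⟩)
      rw [h']
      exact WithTop.coe_le_coe.2 (B.home_le _ _ hj)
  eq_home r c hc hl := by
    simp only [Finset.mem_disjiUnion, mem_map_front] at hl
    obtain ⟨c', hc', hcc, j, hj, hj'⟩ := hl
    rcases r with s | p
    · rcases Finset.mem_insert.1 hc with h | h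
      · exact h
      · rw [mem_map_behind, hj'] at h
        exact absurd h.2 (WithTop.coe_ne_top)
    · obtain ⟨h, j', hj'', h'⟩ := mem_map_front.1 hc
      rw [hj'] at h'
      obtain rfl := WithTop.coe_injective h'
      apply ofLex.injective
      refine Prod.ext h (hj'.trans ?_)
      rw [B.eq_home _ _ hj'' hj]; rfl
  supp_sub r c hc := by
    simp only [Finset.mem_disjiUnion, mem_map_front, Finset.mem_union, Finset.mem_biUnion,
      mem_map_behind]
    rcases r with s | p
    · rcases Finset.mem_insert.1 hc with h | h
      · exact Or.inl ⟨_, A.home_live s, by rw [h]; rfl, _, hmem s, by rw [h]; rfl⟩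
      · rw [mem_map_behind] at h
        exact Or.inr (Or.inr ⟨A.supp_sub _ _ h.1, h.2⟩)
    · obtain ⟨h, j', hj, h'⟩ := mem_map_front.1 hc
      rcases B.supp_sub _ _ hj with hl | hl
      · exact Or.inl ⟨_, (ofLex p).1.2, h, j', hl, h'⟩
      · exact Or.inr (Or.inl ⟨_, (ofLex p).1.2, h, j', hl, h'⟩)
  card_home x hx := by
    simp only [Finset.mem_disjiUnion, mem_map_front] at hx
    obtain ⟨c, hc, hxc, j, hj, hxj⟩ := hx
    obtain rfl : x = toLex (c, (j : WithTop C')) := ofLex.injective (Prod.ext hxc hxj)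
    obtain ⟨s, hs, hsj⟩ := hsurj c hc j hj
    have e : Nat.card (Option {r // B.home r = j}) = m + 1 := by
      rw [Finite.card_option, B.card_home j hj]
    refine Eq.trans ?_ e
    symm
    refine Nat.card_congr (Equiv.ofBijective (fun o => o.elim ⟨toLex (Sum.inl s), ?_⟩
      (fun r => ⟨toLex (Sum.inr (toLex (⟨c, hc⟩, r.1))), ?_⟩)) ⟨?_, ?_⟩)
    · simp [hs, hsj]
    · simp [r.2]
    · rintro (_ | r) (_ | r') h
      · rfl
      · simp at h
      · simp at h
      · simpa [Subtype.ext_iff] using h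
    · rintro ⟨r | p, hr⟩
      · refine ⟨none, Subtype.ext ?_⟩
        replace hr : toLex (A.home r, (g r : WithTop C')) = toLex (c, (j : WithTop C')) := hr
        simp only [toLex_inj, Prod.mk.injEq, WithTop.coe_inj] at hr
        rcases lt_trichotomy r s with h | rfl | h
        · exact absurd (hr.2.trans hsj.symm) (hanti _ _ h (hr.1.trans hs.symm)).ne'
        · rfl
        · exact absurd (hr.2.trans hsj.symm) (hanti _ _ h (hs.trans hr.1.symm)).ne
      · replace hr : toLex ((ofLex p).1.1, ((B.home (ofLex p).2 : C') : WithTop C')) =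
          toLex (c, (j : WithTop C')) := hr
        simp only [toLex_inj, Prod.mk.injEq, WithTop.coe_inj] at hr
        obtain ⟨rfl, hrj⟩ := hr
        exact ⟨some ⟨(ofLex p).2, hrj⟩, rfl⟩
  le_card r := by
    rcases r with s | p
    · refine (Nat.succ_le_succ (A.le_card s)).trans ?_
      refine le_of_eq (Eq.trans ?_ (Finset.card_insert_of_notMem ?_).symm)
      · simp
      · rw [mem_map_behind]
        exact fun h => WithTop.coe_ne_top h.2
    · exact (B.le_card _).trans (Finset.card_map _).ge
  avoid a b hab c₁ h₁ c₂ h₂ c₃ h₃ c₄ h₄ l₁ l₂ l₃ := by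
    rw [Prod.Lex.lt_iff] at l₁ l₂ l₃
    rcases a with s | p <;> rcases b with s' | p'
    · replace hab : s < s' := Sum.Lex.inl_lt_inl_iff.1 hab
      obtain ⟨m₁, t₁⟩ := mem_insert_behind h₁ (A.home_supp s)
      obtain ⟨m₂, t₂⟩ := mem_insert_behind h₂ (A.home_supp s')
      obtain ⟨m₃, t₃⟩ := mem_insert_behind h₃ (A.home_supp s)
      obtain ⟨m₄, t₄⟩ := mem_insert_behind h₄ (A.home_supp s')
      simp only [ofLex_toLex] at t₁ t₂ t₃ t₄
      have e₁ := A.home_le _ _ m₁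
      have e₂ := A.home_le _ _ m₂
      have e₃ := A.home_le _ _ m₃
      have e₄ := A.home_le _ _ m₄
      by_cases hh : A.home s = A.home s'
      -- The new one of `s'` precedes all ones of `s`, so `c₂` is an old column. Then `c₃` and `c₄`
      -- give an `a b` after the common home.
      · have hg := hanti _ _ hab hh
        have u₂ : (ofLex c₂).2 = ⊤ := by
          rcases t₂ with t₂ | t₂
          · exact t₂
          · exfalso
            rcases l₁ with l₁ | l₁
            · exact absurd l₁ (by rw [t₂.1, ← hh]; exact e₁.not_gt)
            · rcases t₁ with t₁ | t₁
              · rw [t₁] at l₁; exact not_top_lt l₁.2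
              · rw [t₁.2, t₂.2, WithTop.coe_lt_coe] at l₁
                exact hg.asymm l₁.2
        have l₂' : (ofLex c₂).1 < (ofLex c₃).1 := by
          rcases l₂ with l₂ | l₂
          · exact l₂
          · rw [u₂] at l₂; exact absurd l₂.2 not_top_lt
        have l₃' : (ofLex c₃).1 < (ofLex c₄).1 := by
          rcases l₃ with l₃ | l₃
          · exact l₃
          · rcases t₃ with t₃ | t₃
            · rw [t₃] at l₃; exact absurd l₃.2 not_top_lt
            · rw [t₃.1, hh] at l₂'
              exact absurd l₂' e₂.not_gt
        exact A.avoid_home _ _ hab hh _ m₃ _ m₄ (by rw [hh]; exact e₂.trans_lt l₂') l₃'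
      -- A home is a live column and carries no one of a row with another home. So contracting each
      -- copy to the column behind it keeps the inequalities strict and leaves an alternation in
      -- `A`.
      · have key : ∀ {a b : R} {x y : C ×ₗ WithTop C'}, A.home a ≠ A.home b →
            (ofLex y).1 ∈ A.supp b →
            ((ofLex x).2 = ⊤ ∨ (ofLex x).1 = A.home a ∧ (ofLex x).2 = (g a : WithTop C')) →
            ((ofLex x).1 < (ofLex y).1 ∨ (ofLex x).1 = (ofLex y).1 ∧ (ofLex x).2 < (ofLex y).2) →
            (ofLex x).1 < (ofLex y).1 := by
          intro a b x y hne hy hx hl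
          rcases hl with hl | hl
          · exact hl
          · rcases hx with hx | hx
            · rw [hx] at hl; exact absurd hl.2 not_top_lt
            · refine absurd (A.eq_home b _ hy ?_) ?_
              · rw [← hl.1, hx.1]; exact A.home_live a
              · rw [← hl.1, hx.1]; exact hne
        exact A.avoid _ _ hab _ m₁ _ m₂ _ m₃ _ m₄ (key hh m₂ t₁ l₁) (key (Ne.symm hh) m₃ t₂ l₂)
          (key hh m₄ t₃ l₃)
    -- Between two ones of a row of a copy, a row of `A` can only have its new one. This is its
    -- first one, so `c₁` cannot precede it.
    · obtain ⟨m₁, t₁⟩ := mem_insert_behind h₁ (A.home_supp s)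
      obtain ⟨m₃, t₃⟩ := mem_insert_behind h₃ (A.home_supp s)
      obtain ⟨m₂, j₂, -, t₂⟩ := mem_map_front.1 h₂
      obtain ⟨m₄, j₄, -, t₄⟩ := mem_map_front.1 h₄
      simp only [ofLex_toLex] at t₁ t₃
      have e₁ := A.home_le _ _ m₁
      rw [m₂] at l₁ l₂
      rw [m₄] at l₃
      have u₃ : (ofLex c₃).1 = (ofLex p').1.1 := by
        rcases l₃ with l₃ | l₃
        · rcases l₂ with l₂ | l₂
          · exact absurd l₂ l₃.asymm
          · exact l₂.1.symm
        · exact l₃.1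
      rw [u₃] at l₂ l₃ t₃
      simp only [lt_irrefl, false_or, true_and] at l₂ l₃
      rcases t₃ with t₃ | t₃
      · rw [t₃] at l₃; exact not_top_lt l₃
      · rw [t₃.1] at l₁
        rcases l₁ with l₁ | l₁
        · exact e₁.not_gt l₁
        · rcases t₁ with t₁ | t₁
          · rw [t₁] at l₁; exact not_top_lt l₁.2
          · rw [t₁.2] at l₁; rw [t₃.2] at l₂
            exact l₁.2.asymm l₂
    · exact Sum.Lex.not_inr_lt_inl hab
    · replace hab : p < p' := Sum.Lex.inr_lt_inr_iff.1 hab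
      obtain ⟨m₁, j₁, n₁, t₁⟩ := mem_map_front.1 h₁
      obtain ⟨m₂, j₂, n₂, t₂⟩ := mem_map_front.1 h₂
      obtain ⟨m₃, j₃, n₃, t₃⟩ := mem_map_front.1 h₃
      obtain ⟨m₄, j₄, n₄, t₄⟩ := mem_map_front.1 h₄
      rw [m₁, m₂, t₁, t₂] at l₁
      rw [m₂, m₃, t₂, t₃] at l₂
      rw [m₃, m₄, t₃, t₄] at l₃
      have h : (ofLex p).1.1 = (ofLex p').1.1 := by
        rcases l₁ with l₁ | l₁
        · rcases l₂ with l₂ | l₂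
          · exact absurd l₂ l₁.asymm
          · exact l₂.1.symm
        · exact l₁.1
      rw [Prod.Lex.lt_iff, ← Subtype.coe_lt_coe, ← Subtype.coe_inj] at hab
      simp only [h, lt_irrefl, false_or, true_and, WithTop.coe_lt_coe] at hab l₁ l₂ l₃
      exact B.avoid _ _ hab _ n₁ _ n₂ _ n₃ _ n₄ l₁ l₂ l₃
  avoid_home a b hab hh c₃ h₃ c₄ h₄ l₂ l₃ := by
    rw [Prod.Lex.lt_iff] at l₂ l₃
    rcases a with s | p <;> rcases b with s' | p'
    · replace hab : s < s' := Sum.Lex.inl_lt_inl_iff.1 hab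
      replace hh : toLex (A.home s, (g s : WithTop C')) = toLex (A.home s', (g s' : WithTop C')) :=
        hh
      simp only [toLex_inj, Prod.mk.injEq, WithTop.coe_inj] at hh
      exact (hanti _ _ hab hh.1).ne' hh.2
    -- After its home the row of `A` has only old columns, which all lie behind the copy that
    -- contains this home.
    · replace hh : toLex (A.home s, (g s : WithTop C')) =
        toLex ((ofLex p').1.1, ((B.home (ofLex p').2 : C') : WithTop C')) := hh
      simp only [toLex_inj, Prod.mk.injEq] at hh
      obtain ⟨m₃, t₃⟩ := mem_insert_behind h₃ (A.home_supp s)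
      obtain ⟨m₄, j₄, -, t₄⟩ := mem_map_front.1 h₄
      replace l₂ : A.home s < (ofLex c₃).1 ∨
        A.home s = (ofLex c₃).1 ∧ (g s : WithTop C') < (ofLex c₃).2 := l₂
      simp only [ofLex_toLex] at t₃
      rw [m₄, ← hh.1] at l₃
      have u₃ : A.home s = (ofLex c₃).1 := by
        rcases l₃ with l₃ | l₃
        · rcases l₂ with l₂ | l₂
          · exact absurd l₂ l₃.asymm
          · exact l₂.1
        · exact l₃.1.symm
      rw [← u₃] at l₂ l₃
      simp only [lt_irrefl, false_or, true_and] at l₂ l₃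
      rcases t₃ with t₃ | t₃
      · rw [t₃] at l₃; exact not_top_lt l₃
      · exact l₂.ne' t₃.2
    · exact Sum.Lex.not_inr_lt_inl hab
    · replace hab : p < p' := Sum.Lex.inr_lt_inr_iff.1 hab
      replace hh : toLex ((ofLex p).1.1, ((B.home (ofLex p).2 : C') : WithTop C')) =
        toLex ((ofLex p').1.1, ((B.home (ofLex p').2 : C') : WithTop C')) := hh
      simp only [toLex_inj, Prod.mk.injEq, WithTop.coe_inj] at hh
      obtain ⟨m₃, j₃, n₃, t₃⟩ := mem_map_front.1 h₃
      obtain ⟨m₄, j₄, n₄, t₄⟩ := mem_map_front.1 h₄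
      replace l₂ : (ofLex p).1.1 < (ofLex c₃).1 ∨ (ofLex p).1.1 = (ofLex c₃).1 ∧
        ((B.home (ofLex p).2 : C') : WithTop C') < (ofLex c₃).2 := l₂
      rw [m₃, t₃] at l₂
      rw [m₃, m₄, t₃, t₄] at l₃
      rw [Prod.Lex.lt_iff, ← Subtype.coe_lt_coe, ← Subtype.coe_inj] at hab
      simp only [hh.1, lt_irrefl, false_or, true_and, WithTop.coe_lt_coe] at hab l₂ l₃
      exact B.avoid_home _ _ hab hh.2 _ n₃ _ n₄ l₂ l₃

theorem card_live_substitute [Inhabited C'] (B : AlternationFree (k + 1) m R' C')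
    (A : AlternationFree k B.live.card R C) (g : R → C') (h₁ h₂ h₃) :
    (substitute B A g h₁ h₂ h₃).live.card = A.live.card * B.live.card :=
  (Finset.card_disjiUnion _ _ (pairwiseDisjoint_map_front _ _)).trans (by simp)

theorem card_dead_substitute_le [Inhabited C'] (B : AlternationFree (k + 1) m R' C')
    (A : AlternationFree k B.live.card R C) (g : R → C') (h₁ h₂ h₃) :
    (substitute B A g h₁ h₂ h₃).dead.card ≤
      A.live.card * B.dead.card + (A.live.card + A.dead.card) := by
  refine (Finset.card_union_le _ _).trans (add_le_add ?_ ?_)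
  · refine Finset.card_biUnion_le.trans (le_of_eq ?_)
    simp
  · rw [Finset.card_map]
    exact Finset.card_union_le _ _

end Substitute
end AlternationFree

/-! ### Superlinearly many ones without alternations. -/

namespace AlternationFree

/-- A live column of `A` is the home of exactly `B.live.card` rows, so these can be matched, in
decreasing order, with the live columns of the copy of `B` in front of it. -/
theorem exists_substitute {k m : ℕ} {R C R' C' : Type} [LinearOrder R] [LinearOrder C]
    [LinearOrder R'] [LinearOrder C'] [Finite R] [Finite R'] (B : AlternationFree (k + 1) m R' C')
    (A : AlternationFree k B.live.card R C) (hB : 0 < B.live.card) :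
    ∃ D : AlternationFree (k + 1) (m + 1) (R ⊕ₗ ({c // c ∈ A.live} ×ₗ R')) (C ×ₗ WithTop C'),
      D.live.card = A.live.card * B.live.card ∧
      D.dead.card ≤ A.live.card * B.dead.card + (A.live.card + A.dead.card) := by
  classical
  have := Fintype.ofFinite R
  obtain ⟨c₀, -⟩ := Finset.card_pos.1 hB
  have : Inhabited C' := ⟨c₀⟩
  have hex : ∀ c : C, ∃ g : R → C', c ∈ A.live →
      Set.BijOn g (Finset.univ.filter fun r => A.home r = c : Finset R) B.live ∧
      StrictAntiOn g (Finset.univ.filter fun r => A.home r = c : Finset R) := by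
    intro c
    by_cases hc : c ∈ A.live
    · obtain ⟨g, hg⟩ := exists_strictAntiOn_bijOn
        (Finset.univ.filter fun r => A.home r = c : Finset R) B.live (by
          rw [← Fintype.card_subtype, ← Nat.card_eq_fintype_card]
          exact A.card_home c hc)
      exact ⟨g, fun _ => hg⟩
    · exact ⟨fun _ => default, fun h => absurd h hc⟩
  choose g hg using hex
  have hg' := fun r : R => hg (A.home r) (A.home_live r)
  have hmem : ∀ {r c}, A.home r = c →
      r ∈ ((Finset.univ.filter fun r => A.home r = c : Finset R) : Set R) := fun h => by simp [h]
  refine ⟨substitute B A (fun r => g (A.home r) r) (fun r => (hg' r).1.mapsTo (hmem rfl))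
    (fun s s' h hh => ?_) (fun c hc j hj => ?_), card_live_substitute _ _ _ _ _ _,
    card_dead_substitute_le _ _ _ _ _ _⟩
  · simp only [hh]
    exact (hg' s').2 (hmem hh) (hmem rfl) h
  · obtain ⟨s, hs, hsj⟩ := (hg c hc).1.surjOn hj
    have hs' : A.home s = c := by simpa using hs
    exact ⟨s, hs', by rw [hs']; exact hsj⟩

/-- Rows with many ones come at the cost of dead columns, and this bounds their share. Substitution
adds a one to each row of `A` and a row to each live column of `B`. The columns of `A` die, but the
live ones are replaced by `B.live.card` times as many. -/
theorem exists_dead_card_le (k q m : ℕ) :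
    ∃ (R C : Type) (_ : LinearOrder R) (_ : LinearOrder C) (_ : Finite R)
      (A : AlternationFree k m R C), 0 < A.live.card ∧ q * A.dead.card ≤ m * A.live.card := by
  induction k generalizing q m with
  | zero =>
    exact ⟨Fin m, Unit, inferInstance, inferInstance, inferInstance, single 0 m (Or.inl rfl),
      by simp [single], by simp [single]⟩
  | succ k ih =>
    induction m with
    | zero =>
      exact ⟨Fin 0, Unit, inferInstance, inferInstance, inferInstance,
        single (k + 1) 0 (Or.inr rfl), by simp [single], by simp [single]⟩
    | succ m ihm =>
      obtain ⟨R', C', _, _, _, B₀, hB₀, hd₀⟩ := ihm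
      have : Finite (Fin (2 * q + 1) ×ₗ R') := inferInstanceAs (Finite (Fin (2 * q + 1) × R'))
      -- Copies keep the ratio of dead to live columns and supply at least `2 * q` live ones. This
      -- charges `q * A.live.card` to one half of `A.live.card * B.live.card`; the parameter `2 * q`
      -- for `A` charges `q * A.dead.card` to the other half.
      obtain ⟨B, hB⟩ : ∃ B, B = B₀.copies (2 * q + 1) := ⟨_, rfl⟩
      have hl : B.live.card = (2 * q + 1) * B₀.live.card := by rw [hB, card_live_copies]
      have hd : B.dead.card = (2 * q + 1) * B₀.dead.card := by rw [hB, card_dead_copies]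
      have hBd : q * B.dead.card ≤ m * B.live.card := by
        rw [hl, hd]
        calc q * ((2 * q + 1) * B₀.dead.card) = (2 * q + 1) * (q * B₀.dead.card) := by ring
          _ ≤ (2 * q + 1) * (m * B₀.live.card) := Nat.mul_le_mul_left _ hd₀
          _ = _ := by ring
      have hBq : 2 * q ≤ B.live.card := by rw [hl]; nlinarith
      have hBl : 0 < B.live.card := by rw [hl]; positivity
      obtain ⟨R, C, _, _, _, A, hA, hAd⟩ := ih (2 * q) B.live.card
      obtain ⟨D, hDl, hDd⟩ := exists_substitute B A hBl
      have : Finite ({c // c ∈ A.live} ×ₗ (Fin (2 * q + 1) ×ₗ R')) :=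
        inferInstanceAs (Finite ({c // c ∈ A.live} × (Fin (2 * q + 1) ×ₗ R')))
      refine ⟨_, _, inferInstance, inferInstance,
        inferInstanceAs (Finite (R ⊕ ({c // c ∈ A.live} ×ₗ (Fin (2 * q + 1) ×ₗ R')))), D, ?_, ?_⟩
      · rw [hDl]; positivity
      · rw [hDl]
        have h₁ := Nat.mul_le_mul_left A.live.card hBd
        have h₂ := Nat.mul_le_mul_left A.live.card hBq
        have h₃ := Nat.mul_le_mul_left q hDd
        nlinarith

section Card

variable {k m : ℕ} {R C : Type} [LinearOrder R] [LinearOrder C] [Fintype R]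

theorem card_rows (A : AlternationFree k m R C) : Fintype.card R = m * A.live.card := by
  classical
  rw [← Finset.card_univ, Finset.card_eq_sum_card_fiberwise (f := A.home) (t := A.live)
    (fun r _ => A.home_live r), Finset.sum_congr rfl (g := fun _ => m), Finset.sum_const,
    smul_eq_mul, mul_comm]
  intro c hc
  rw [← Fintype.card_subtype, ← Nat.card_eq_fintype_card]
  exact A.card_home c hc

theorem exists_finset (A : AlternationFree k m R C) (n : ℕ) (hR : Fintype.card R ≤ n)
    (hC : A.live.card + A.dead.card ≤ n) :
    ∃ E : Finset (Fin n × Fin n), k * Fintype.card R ≤ E.card ∧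
      ∀ a b, a < b → ∀ c₁ c₂ c₃ c₄, c₁ < c₂ → c₂ < c₃ → c₃ < c₄ →
        (a, c₁) ∈ E → (b, c₂) ∈ E → (a, c₃) ∈ E → (b, c₄) ∉ E := by
  classical
  set T := A.live ∪ A.dead
  have hTn : T.card ≤ n := (Finset.card_union_le _ _).trans hC
  let row : R ↪o Fin n := (monoEquivOfFin R rfl).symm.toOrderEmbedding.trans (Fin.castLEOrderEmb hR)
  let col : T ↪o Fin n := (T.orderIsoOfFin rfl).symm.toOrderEmbedding.trans (Fin.castLEOrderEmb hTn)
  let E : Finset (Fin n × Fin n) := ((Finset.univ : Finset (R × T)).filter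
    (fun x => x.2.1 ∈ A.supp x.1)).map (row.toEmbedding.prodMap col.toEmbedding)
  have hE : ∀ {a c}, (a, c) ∈ E → ∃ r, ∃ t : T, t.1 ∈ A.supp r ∧ row r = a ∧ col t = c := by
    intro a c h
    obtain ⟨⟨r, t⟩, hx, hx'⟩ := Finset.mem_map.1 h
    rw [Finset.mem_filter] at hx
    exact ⟨r, t, hx.2, (Prod.mk.inj hx').1, (Prod.mk.inj hx').2⟩
  refine ⟨E, ?_, ?_⟩
  · rw [Finset.card_map]
    have h : ∀ r, ∀ c ∈ A.supp r, c ∈ T := fun r c hc => Finset.mem_union.2 (A.supp_sub r c hc)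
    calc k * Fintype.card R = ∑ r : R, k := by simp [mul_comm]
      _ ≤ ∑ r : R, (A.supp r).attach.card :=
        Finset.sum_le_sum fun r _ => by rw [Finset.card_attach]; exact A.le_card r
      _ = (Finset.univ.sigma fun r : R => (A.supp r).attach).card := (Finset.card_sigma _ _).symm
      _ ≤ _ := Finset.card_le_card_of_injOn (fun x => (x.1, ⟨x.2.1, h _ _ x.2.2⟩))
        (fun x _ => by simp [x.2.2]) ?_
    rintro ⟨r, c, hc⟩ - ⟨r', c', hc'⟩ - hx
    simp only [Prod.mk.injEq, Subtype.mk.injEq] at hx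
    obtain ⟨rfl, rfl⟩ := hx
    rfl
  · intro a b hab c₁ c₂ c₃ c₄ l₁ l₂ l₃ h₁ h₂ h₃ h₄
    obtain ⟨r, t₁, s₁, rfl, rfl⟩ := hE h₁
    obtain ⟨r', t₂, s₂, rfl, rfl⟩ := hE h₂
    obtain ⟨r₃, t₃, s₃, e₃, rfl⟩ := hE h₃
    obtain ⟨r₄, t₄, s₄, e₄, rfl⟩ := hE h₄
    obtain rfl := row.injective e₃
    obtain rfl := row.injective e₄
    rw [OrderEmbedding.lt_iff_lt] at hab l₁ l₂ l₃
    exact A.avoid _ _ hab _ s₁ _ s₂ _ s₃ _ s₄ l₁ l₂ l₃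

end Card

end AlternationFree

/-- The 0-1 matrices that avoid an alternation `a b a b` of rows `a < b` can have superlinearly many
ones. -/
theorem exists_finset_alternation_free (K : ℕ) : ∃ N, ∀ n ≥ N, ∃ E : Finset (Fin n × Fin n),
    K * n ≤ E.card ∧ ∀ a b, a < b → ∀ c₁ c₂ c₃ c₄, c₁ < c₂ → c₂ < c₃ → c₃ < c₄ →
      (a, c₁) ∈ E → (b, c₂) ∈ E → (a, c₃) ∈ E → (b, c₄) ∉ E := by
  -- With `q = m = 2` there are `2 * A.live.card` rows and at most as many columns. The factor in `2
  -- * K` compensates for diagonal copies that may fill only half of `n`.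
  obtain ⟨R, C, _, _, _, A, hA, hd⟩ := AlternationFree.exists_dead_card_le (2 * K) 2 2
  have := Fintype.ofFinite R
  refine ⟨2 * A.live.card, fun n hn => ?_⟩
  have hp := Nat.div_mul_le_self n (2 * A.live.card)
  have hp' := Nat.lt_div_mul_add (a := n) (b := 2 * A.live.card) (by positivity)
  have hp1 : 1 ≤ n / (2 * A.live.card) := (Nat.one_le_div_iff (by positivity)).2 hn
  set p := n / (2 * A.live.card)
  have : Fintype (Fin p ×ₗ R) := inferInstanceAs (Fintype (Fin p × R))
  have hc := (A.copies p).card_rows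
  rw [AlternationFree.card_live_copies] at hc
  obtain ⟨E, hE, hE'⟩ := (A.copies p).exists_finset n (by rw [hc]; nlinarith) (by
    rw [AlternationFree.card_live_copies, AlternationFree.card_dead_copies]
    nlinarith)
  refine ⟨E, le_trans ?_ hE, hE'⟩
  rw [hc]
  have : n ≤ 2 * (2 * (p * A.live.card)) := by nlinarith
  calc K * n ≤ K * (2 * (2 * (p * A.live.card))) := Nat.mul_le_mul_left _ this
    _ = _ := by ring

/-! ### Füredi's matrix. -/

/-- Füredi's matrix: its ones are at the positions `(i, i + 2 ^ e)`. -/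
theorem exists_finset_furedi_free (K : ℕ) : ∃ N, ∀ n ≥ N, ∃ E : Finset (Fin n × Fin n),
    K * n ≤ E.card ∧ ∀ a b, a < b → ∀ c₁ c₂ c₃, c₁ ≤ c₂ → c₂ < c₃ →
      (b, c₁) ∈ E → (a, c₂) ∈ E → (a, c₃) ∈ E → (b, c₃) ∉ E := by
  classical
  refine ⟨2 * 2 ^ (2 * K), fun n hn => ?_⟩
  refine ⟨Finset.univ.filter fun p => ∃ e : ℕ, (p.2 : ℕ) = p.1 + 2 ^ e, ?_, ?_⟩
  · calc K * n ≤ K * (2 * (n - 2 ^ (2 * K))) := Nat.mul_le_mul_left _ (by omega)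
      _ = 2 * K * (n - 2 ^ (2 * K)) := by ring
      _ = (Finset.univ : Finset (Fin (2 * K) × Fin (n - 2 ^ (2 * K)))).card := by simp
      _ ≤ _ := by
        have hlt : ∀ (e : Fin (2 * K)) (i : Fin (n - 2 ^ (2 * K))), (i : ℕ) + 2 ^ (e : ℕ) < n := by
          intro e i
          have : 2 ^ (e : ℕ) ≤ 2 ^ (2 * K) := Nat.pow_le_pow_right (by norm_num) e.2.le
          have := i.2
          omega
        refine Finset.card_le_card_of_injOn
          (fun p => (⟨p.2, by have := hlt p.1 p.2; omega⟩, ⟨p.2 + 2 ^ (p.1 : ℕ), hlt _ _⟩))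
          (fun p _ => by simp) ?_
        rintro ⟨e, i⟩ - ⟨e', i'⟩ - h
        simp only [Prod.mk.injEq, Fin.mk.injEq] at h
        obtain ⟨h₁, h₂⟩ := h
        rw [h₁] at h₂
        exact Prod.ext (Fin.ext (Nat.pow_right_injective le_rfl (Nat.add_left_cancel h₂)))
          (Fin.ext h₁)
  · intro a b hab c₁ c₂ c₃ l₁ l₂ h₁ h₂ h₃ h₄
    simp only [Finset.mem_filter, Finset.mem_univ, true_and] at h₁ h₂ h₃ h₄
    obtain ⟨u, hu⟩ := h₁
    obtain ⟨x, hx⟩ := h₂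
    obtain ⟨y, hy⟩ := h₃
    obtain ⟨v, hv⟩ := h₄
    rw [Fin.lt_def] at hab l₂
    rw [Fin.le_def] at l₁
    -- As `x` and `v` are less than `y`, `c₂ ≤ a + 2 ^ (y - 1) = c₃ - 2 ^ (y - 1) ≤ c₃ - 2 ^ v = b <
    -- c₁`.
    have hxy : x < y := (Nat.pow_lt_pow_iff_right (a := 2) (by norm_num)).1 (by omega)
    have hvy : v < y := (Nat.pow_lt_pow_iff_right (a := 2) (by norm_num)).1 (by omega)
    have p₁ : 2 ^ (x + 1) ≤ 2 ^ y := Nat.pow_le_pow_right (by norm_num) hxy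
    have p₂ : 2 ^ (v + 1) ≤ 2 ^ y := Nat.pow_le_pow_right (by norm_num) hvy
    have p₃ := Nat.pos_of_neZero (2 ^ u)
    rw [pow_succ] at p₁ p₂
    omega

/-- Turns a family of square 0-1 matrices upside down. -/
theorem exists_finset_rev {K n : ℕ} {p : Finset (Fin n × Fin n) → Prop}
    (h : ∃ E : Finset (Fin n × Fin n), K * n ≤ E.card ∧ p E) :
    ∃ E : Finset (Fin n × Fin n), K * n ≤ E.card ∧
      p (E.map (Equiv.prodCongr Fin.revPerm (Equiv.refl _)).toEmbedding) := by
  obtain ⟨E, hE, hp⟩ := h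
  refine ⟨E.map (Equiv.prodCongr Fin.revPerm (Equiv.refl _)).toEmbedding, by simpa using hE, ?_⟩
  convert hp
  ext ⟨a, b⟩
  simp

/-! ### Superlinearity by projection to two dimensions. -/

namespace ZeroOneMatrix

theorem le_ex {d n : ℕ} {P : ZeroOneMatrix d} (A : ZeroOneMatrix d) (hA : ∀ i, A.side i = n)
    (h : ¬ A.Contains P) : A.weight ≤ ex n P :=
  le_csSup (bddAbove_freeWeights n P) ⟨A, hA, h, rfl⟩

variable {m : ℕ}

/-- A matrix is not `O(n ^ m)` if there are square matrices with superlinearly many ones which avoid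
its projection to the dimension `i` and the last one. -/
theorem isLittleO_ex_of_projection (M : ZeroOneMatrix (m + 1)) (i : Fin m)
    (h : ∀ K : ℕ, ∃ N, ∀ n ≥ N, ∃ E : Finset (Fin n × Fin n), K * n ≤ E.card ∧
      ∀ (φ : Fin (M.side i.castSucc) ↪o Fin n) (ψ : Fin (M.side (Fin.last m)) ↪o Fin n),
        ∃ x, M.entry x = true ∧ (φ (x i.castSucc), ψ (x (Fin.last m))) ∉ E) :
    (fun n : ℕ => (n : ℝ) ^ m) =o[Filter.atTop] fun n : ℕ => (ex n M : ℝ) := by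
  rw [Asymptotics.isLittleO_iff_nat_mul_le]
  intro K
  obtain ⟨N, hN⟩ := h K
  filter_upwards [Filter.eventually_ge_atTop (N + 1)] with n hn
  obtain ⟨E, hE, hE'⟩ := hN n (by omega)
  -- The product of `E` with all values of the remaining `m - 1` coordinates.
  let A : ZeroOneMatrix (m + 1) := ⟨fun _ => n, fun _ => by omega,
    fun x => decide ((x i.castSucc, x (Fin.last m)) ∈ E)⟩
  have hA : ¬ A.Contains M := by
    rintro ⟨f, hf⟩
    obtain ⟨x, hx, hx'⟩ := hE' (f i.castSucc) (f (Fin.last m))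
    exact hx' (of_decide_eq_true (hf x hx))
  have hw : K * n ^ m ≤ A.weight := by
    obtain ⟨m, rfl⟩ : ∃ m', m = m' + 1 := ⟨m - 1, by have := i.2; omega⟩
    calc K * n ^ (m + 1) = K * n * n ^ m := by ring
      _ ≤ E.card * n ^ m := Nat.mul_le_mul_right _ hE
      _ = (E ×ˢ (Finset.univ : Finset (Fin m → Fin n))).card := by simp
      _ ≤ _ := by
        refine Finset.card_le_card_of_injOn
          (fun p => (Fin.snoc (i.insertNth p.1.1 p.2 : Fin (m + 1) → Fin n) p.1.2 :
            Fin (m + 1 + 1) → Fin n)) ?_ ?_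
        · rintro ⟨⟨a, c⟩, y⟩ hp
          have hp' : (a, c) ∈ E := (Finset.mem_product.1 hp).1
          simpa [A] using hp'
        · rintro ⟨⟨a, c⟩, y⟩ - ⟨⟨a', c'⟩, y'⟩ - hp
          simp only at hp
          have h₁ := Fin.snoc_inj.1 hp
          have h₂ := Fin.insertNth_inj.1 h₁.1
          rw [h₁.2, h₂.1, h₂.2]
  have := hw.trans (le_ex A (fun _ => rfl) hA)
  rw [Real.norm_of_nonneg (by positivity), Real.norm_of_nonneg (by positivity)]
  exact_mod_cast this

/-- A matrix whose projection contains the alternation `a b a b` is not `O(n ^ m)`. -/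
theorem isLittleO_ex_of_alternation (M : ZeroOneMatrix (m + 1)) (i : Fin m)
    (x₁ x₂ x₃ x₄ : ∀ j, Fin (M.side j)) (h₁ : M.entry x₁ = true) (h₂ : M.entry x₂ = true)
    (h₃ : M.entry x₃ = true) (h₄ : M.entry x₄ = true)
    (h₁₃ : x₁ i.castSucc = x₃ i.castSucc) (h₂₄ : x₂ i.castSucc = x₄ i.castSucc)
    (hne : x₁ i.castSucc ≠ x₂ i.castSucc) (l₁ : x₁ (Fin.last m) < x₂ (Fin.last m))
    (l₂ : x₂ (Fin.last m) < x₃ (Fin.last m)) (l₃ : x₃ (Fin.last m) < x₄ (Fin.last m)) :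
    (fun n : ℕ => (n : ℝ) ^ m) =o[Filter.atTop] fun n : ℕ => (ex n M : ℝ) := by
  apply isLittleO_ex_of_projection M i
  intro K
  obtain ⟨N, hN⟩ := exists_finset_alternation_free K
  refine ⟨N, fun n hn => ?_⟩
  rcases hne.lt_or_gt with hlt | hlt
  · obtain ⟨E, hE, hE'⟩ := hN n hn
    refine ⟨E, hE, fun φ ψ => ?_⟩
    by_contra! hc
    have g₃ := hc x₃ h₃
    have g₄ := hc x₄ h₄
    rw [← h₁₃] at g₃
    rw [← h₂₄] at g₄
    exact hE' _ _ (φ.lt_iff_lt.2 hlt) _ _ _ _ (ψ.lt_iff_lt.2 l₁) (ψ.lt_iff_lt.2 l₂)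
      (ψ.lt_iff_lt.2 l₃) (hc x₁ h₁) (hc x₂ h₂) g₃ g₄
  · obtain ⟨E, hE, hE'⟩ := exists_finset_rev (hN n hn)
    refine ⟨E, hE, fun φ ψ => ?_⟩
    by_contra! hc
    have g₃ := hc x₃ h₃
    have g₄ := hc x₄ h₄
    rw [← h₁₃] at g₃
    rw [← h₂₄] at g₄
    refine hE' _ _ (Fin.rev_lt_rev.2 (φ.lt_iff_lt.2 hlt)) _ _ _ _ (ψ.lt_iff_lt.2 l₁)
      (ψ.lt_iff_lt.2 l₂) (ψ.lt_iff_lt.2 l₃) ?_ ?_ ?_ ?_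
    · simpa using hc x₁ h₁
    · simpa using hc x₂ h₂
    · simpa using g₃
    · simpa using g₄

/-- A matrix whose projection contains two rows with ones in a common column, each of which has an
earlier one, is not `O(n ^ m)`. -/
theorem isLittleO_ex_of_furedi (M : ZeroOneMatrix (m + 1)) (i : Fin m)
    (x₁ x₂ x₃ x₄ : ∀ j, Fin (M.side j)) (h₁ : M.entry x₁ = true) (h₂ : M.entry x₂ = true)
    (h₃ : M.entry x₃ = true) (h₄ : M.entry x₄ = true)
    (h₂₃ : x₂ i.castSucc = x₃ i.castSucc) (h₁₄ : x₁ i.castSucc = x₄ i.castSucc)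
    (hne : x₁ i.castSucc ≠ x₂ i.castSucc) (l₁ : x₁ (Fin.last m) ≤ x₂ (Fin.last m))
    (l₂ : x₂ (Fin.last m) < x₃ (Fin.last m)) (l₃ : x₃ (Fin.last m) = x₄ (Fin.last m)) :
    (fun n : ℕ => (n : ℝ) ^ m) =o[Filter.atTop] fun n : ℕ => (ex n M : ℝ) := by
  apply isLittleO_ex_of_projection M i
  intro K
  obtain ⟨N, hN⟩ := exists_finset_furedi_free K
  refine ⟨N, fun n hn => ?_⟩
  rcases hne.lt_or_gt with hlt | hlt
  · obtain ⟨E, hE, hE'⟩ := exists_finset_rev (hN n hn)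
    refine ⟨E, hE, fun φ ψ => ?_⟩
    by_contra! hc
    have g₃ := hc x₃ h₃
    have g₄ := hc x₄ h₄
    rw [← h₂₃] at g₃
    rw [← h₁₄, ← l₃] at g₄
    refine hE' _ _ (Fin.rev_lt_rev.2 (φ.lt_iff_lt.2 hlt)) _ _ _ (ψ.le_iff_le.2 l₁)
      (ψ.lt_iff_lt.2 l₂) ?_ ?_ ?_ ?_
    · simpa using hc x₁ h₁
    · simpa using hc x₂ h₂
    · simpa using g₃
    · simpa using g₄
  · obtain ⟨E, hE, hE'⟩ := hN n hn
    refine ⟨E, hE, fun φ ψ => ?_⟩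
    by_contra! hc
    have g₃ := hc x₃ h₃
    have g₄ := hc x₄ h₄
    rw [← h₂₃] at g₃
    rw [← h₁₄, ← l₃] at g₄
    exact hE' _ _ (φ.lt_iff_lt.2 hlt) _ _ _ (ψ.le_iff_le.2 l₁) (ψ.lt_iff_lt.2 l₂)
      (hc x₁ h₁) (hc x₂ h₂) g₃ g₄

end ZeroOneMatrix

/-! ### Reductions for minimal matrices. -/

namespace ZeroOneMatrix

/-- The matrix `M` is contained in the cubic matrix with the set `E` of ones. -/
def ContainedIn {d n : ℕ} (M : ZeroOneMatrix d) (E : Finset (Fin d → Fin n)) : Prop :=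
  ∃ f : ∀ i, Fin (M.side i) ↪o Fin n, ∀ x, M.entry x = true → (fun i => f i (x i)) ∈ E

theorem card_le_ex {d n : ℕ} (hn : 0 < n) {P : ZeroOneMatrix d} {E : Finset (Fin d → Fin n)}
    (h : ¬ P.ContainedIn E) : E.card ≤ ex n P := by
  classical
  refine le_trans (le_of_eq ?_) (le_ex (⟨fun _ => n, fun _ => hn, fun x => decide (x ∈ E)⟩ :
    ZeroOneMatrix d) (fun _ => rfl) ?_)
  · simp [weight]
  · rintro ⟨f, hf⟩
    exact h ⟨f, fun x hx => of_decide_eq_true (hf x hx)⟩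

theorem ex_le {d n B : ℕ} {P : ZeroOneMatrix d}
    (h : ∀ E : Finset (Fin d → Fin n), ¬ P.ContainedIn E → E.card ≤ B) : ex n P ≤ B := by
  refine csSup_le' ?_
  rintro w ⟨⟨side, pos, entry⟩, hA, hP, rfl⟩
  obtain rfl : side = fun _ => n := funext hA
  refine h _ ?_
  rintro ⟨f, hf⟩
  exact hP ⟨f, fun x hx => (Finset.mem_filter.1 (hf x hx)).2⟩

/-- The matrix with the same dimensions and other entries. -/
def withEntry {d : ℕ} (M : ZeroOneMatrix d) (e : (∀ i, Fin (M.side i)) → Bool) :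
    ZeroOneMatrix d := ⟨M.side, M.side_pos, e⟩

theorem contains_withEntry {d : ℕ} (M : ZeroOneMatrix d) {e : (∀ i, Fin (M.side i)) → Bool}
    (he : ∀ x, e x = true → M.entry x = true) : M.Contains (M.withEntry e) :=
  ⟨fun _ => RelEmbedding.refl _, he⟩

theorem withEntry_ne {d : ℕ} (M : ZeroOneMatrix d) {e : (∀ i, Fin (M.side i)) → Bool}
    (he : e ≠ M.entry) : M.withEntry e ≠ M := by
  obtain ⟨s, p, e'⟩ := M
  intro h
  simp only [withEntry, mk.injEq, heq_eq_eq, true_and] at h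
  exact he h

/-- The matrix without a one at `x`. -/
def erase {d : ℕ} (M : ZeroOneMatrix d) (x : ∀ i, Fin (M.side i)) : ZeroOneMatrix d :=
  M.withEntry fun y => M.entry y && decide (y ≠ x)

theorem contains_erase {d : ℕ} (M : ZeroOneMatrix d) (x : ∀ i, Fin (M.side i)) :
    M.Contains (M.erase x) :=
  M.contains_withEntry fun _ hy => (Bool.and_eq_true_iff.1 hy).1

theorem erase_ne {d : ℕ} (M : ZeroOneMatrix d) {x : ∀ i, Fin (M.side i)}
    (h : M.entry x = true) : M.erase x ≠ M :=
  M.withEntry_ne fun he => by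
    have := congrFun he x
    simp [h] at this

/-- The submatrix of the chosen coordinates. -/
def submatrix {d : ℕ} (M : ZeroOneMatrix d) (U : ∀ i, Finset (Fin (M.side i)))
    (hU : ∀ i, (U i).Nonempty) : ZeroOneMatrix d :=
  ⟨fun i => (U i).card, fun i => (hU i).card_pos,
    fun x => M.entry fun i => (U i).orderEmbOfFin rfl (x i)⟩

theorem contains_submatrix {d : ℕ} (M : ZeroOneMatrix d) (U : ∀ i, Finset (Fin (M.side i)))
    (hU : ∀ i, (U i).Nonempty) : M.Contains (M.submatrix U hU) :=
  ⟨fun i => (U i).orderEmbOfFin rfl, fun _ hx => hx⟩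

variable {m : ℕ}

theorem not_isLittleO_zero :
    ¬ (fun n : ℕ => (n : ℝ) ^ m) =o[Filter.atTop] fun n : ℕ => (n : ℝ) ^ m := by
  intro h
  rw [Asymptotics.isLittleO_iff_nat_mul_le] at h
  obtain ⟨n, h₁, h₂⟩ := ((h 2).and (Filter.eventually_ge_atTop 1)).exists
  have h₃ : 0 < (n : ℝ) ^ m := pow_pos (by exact_mod_cast h₂) m
  rw [Real.norm_of_nonneg h₃.le, Nat.cast_ofNat] at h₁
  linarith

namespace IsMinimallyNonO

variable {M : ZeroOneMatrix (m + 1)}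

theorem isLittleO (hM : M.IsMinimallyNonO) :
    (fun n : ℕ => (n : ℝ) ^ m) =o[Filter.atTop] fun n : ℕ => (ex n M : ℝ) := hM.1

theorem isBigO (hM : M.IsMinimallyNonO) {Q : ZeroOneMatrix (m + 1)} (h : M.Contains Q)
    (hne : Q ≠ M) : (fun n : ℕ => (ex n Q : ℝ)) =O[Filter.atTop] fun n : ℕ => (n : ℝ) ^ m :=
  hM.2 Q h hne

/-- The form in which minimality is applied to the two planar patterns: a few ones that already
force superlinear growth are all the ones. -/
theorem entry_eq_of_isLittleO (hM : M.IsMinimallyNonO) {e : (∀ i, Fin (M.side i)) → Bool}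
    (he : ∀ x, e x = true → M.entry x = true)
    (h : (fun n : ℕ => (n : ℝ) ^ m) =o[Filter.atTop] fun n : ℕ => (ex n (M.withEntry e) : ℝ)) :
    e = M.entry := by
  by_contra hne
  exact not_isLittleO_zero (h.trans_isBigO
    (hM.isBigO (M.contains_withEntry he) (M.withEntry_ne hne)))

/-- A linear bound for `ex n M` in terms of `ex n Q` is impossible for `Q` properly contained in
`M`. -/
theorem false_of_le (hM : M.IsMinimallyNonO) {Q : ZeroOneMatrix (m + 1)} (h : M.Contains Q)
    (hne : Q ≠ M) (a b N : ℕ) (hle : ∀ n > N, ∀ E : Finset (Fin (m + 1) → Fin n),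
      ¬ M.ContainedIn E → E.card ≤ a * ex n Q + b * n ^ m) : False := by
  refine not_isLittleO_zero (hM.isLittleO.trans_isBigO ?_)
  have h₁ : (fun n : ℕ => (ex n M : ℝ)) =O[Filter.atTop]
      fun n : ℕ => ((a : ℝ) * ex n Q + b * (n : ℝ) ^ m) := by
    refine Asymptotics.IsBigO.of_bound 1 ?_
    filter_upwards [Filter.eventually_gt_atTop N] with n hn
    rw [Real.norm_of_nonneg (by positivity), Real.norm_of_nonneg (by positivity), one_mul]
    exact_mod_cast ex_le (hle n hn)
  refine h₁.trans (((hM.isBigO h hne).const_mul_left _).add ?_)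
  exact (Asymptotics.isBigO_refl _ _).const_mul_left _

end IsMinimallyNonO

theorem card_filter_last_le {n : ℕ} (S : Finset (Fin n)) :
    (Finset.univ.filter fun x : Fin (m + 1) → Fin n => x (Fin.last m) ∈ S).card ≤
      S.card * n ^ m := by
  calc _ ≤ (S ×ˢ (Finset.univ : Finset (Fin m → Fin n))).card := by
        refine Finset.card_le_card_of_injOn (fun x => (x (Fin.last m), Fin.init x))
          (fun x hx => by simpa using hx) ?_
        intro x _ y _ h
        simp only [Prod.mk.injEq] at h
        rw [← Fin.snoc_init_self x, ← Fin.snoc_init_self y, h.1, h.2]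
    _ = _ := by simp

/-- Embeddings with large gaps extend. -/
theorem exists_orderEmbedding_extend {s J n r : ℕ} (hs : 0 < s) (f : Fin s ↪o Fin J)
    (g : Fin s ↪o Fin n) (hg : ∀ y, J ≤ (g y : ℕ) ∧ (g y : ℕ) + J < n ∧ (g y : ℕ) % J = r) :
    ∃ h : Fin J ↪o Fin n, ∀ y, h (f y) = g y := by
  -- `F` continues in steps of one from the prescribed values. Distinct values of `g` are congruent
  -- modulo `J`, hence at least `J` apart and never overrun; the margins of `J` leave room before
  -- the first and after the last.
  let F : ℕ → ℕ := fun c => max c ((Finset.univ.filter fun y : Fin s => (f y : ℕ) ≤ c).sup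
    fun y => (g y : ℕ) + (c - f y))
  have hF : ∀ y c, (f y : ℕ) ≤ c → (g y : ℕ) + (c - f y) ≤ F c := fun y c h =>
    le_max_of_le_right (Finset.le_sup (f := fun y : Fin s => (g y : ℕ) + (c - f y))
      (Finset.mem_filter.2 ⟨Finset.mem_univ _, h⟩))
  have hlt : ∀ c c', c < c' → F c < F c' := by
    intro c c' h
    have h' : c' ≤ F c' := le_max_left _ _
    refine max_lt (h.trans_le h') ((Finset.sup_lt_iff (Nat.bot_eq_zero ▸ by omega)).2 fun y hy => ?_)
    have hy' := (Finset.mem_filter.1 hy).2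
    have := hF y c' (by omega)
    omega
  have heq : ∀ y, F (f y) = g y := by
    intro y
    refine le_antisymm (max_le ?_ (Finset.sup_le fun z hz => ?_)) ?_
    · exact (f y).2.le.trans (hg y).1
    · have hz' := (Finset.mem_filter.1 hz).2
      rcases (f.le_iff_le.1 (Fin.le_def.2 hz')).lt_or_eq with h | rfl
      · have h₁ : (g z : ℕ) < g y := g.lt_iff_lt.2 h
        have h₂ : (g z : ℕ) ≡ g y [MOD J] := ((hg z).2.2).trans (hg y).2.2.symm
        have h₃ := Nat.le_of_dvd (by omega) ((Nat.modEq_iff_dvd' h₁.le).1 h₂)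
        have := (f y).2
        omega
      · omega
    · have := hF y (f y) le_rfl
      omega
  have hn : ∀ c : Fin J, F c < n := by
    intro c
    have := hg ⟨0, hs⟩
    refine max_lt (by omega) ((Finset.sup_lt_iff (Nat.bot_eq_zero ▸ by omega)).2 fun y hy => ?_)
    have := hg y
    omega
  exact ⟨OrderEmbedding.ofStrictMono (fun c => ⟨F c, hn c⟩) fun c c' h => hlt c c' h,
    fun y => Fin.ext (heq y)⟩

theorem exists_orderEmbedding_update {J n : ℕ} (g : Fin J ↪o Fin n) (c : Fin J) (p : Fin n)
    (h₁ : ∀ c' < c, g c' < p) (h₂ : ∀ c' > c, p < g c') :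
    ∃ h : Fin J ↪o Fin n, h c = p ∧ ∀ c' ≠ c, h c' = g c' := by
  suffices hm : StrictMono (Function.update g c p) from ⟨OrderEmbedding.ofStrictMono _ hm,
    Function.update_self _ _ _, fun c' h => Function.update_of_ne h _ _⟩
  intro a b hab
  by_cases ha : a = c
  · subst ha
    simpa [hab.ne'] using h₂ b hab
  · by_cases hb : b = c
    · subst hb
      simpa [ha] using h₁ a hab
    · simpa [ha, hb] using hab

namespace IsMinimallyNonO

variable {M : ZeroOneMatrix (m + 1)}

theorem exists_entry (hM : M.IsMinimallyNonO) : ∃ x, M.entry x = true := by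
  by_contra! hz
  have h0 : (fun n : ℕ => (ex n M : ℝ)) =O[Filter.atTop] fun n : ℕ => (n : ℝ) ^ m := by
    refine Asymptotics.IsBigO.of_bound 1 ?_
    filter_upwards [Filter.eventually_ge_atTop (Finset.univ.sup M.side)] with n hn
    have : ex n M ≤ 0 := ex_le fun E hE => absurd
      ⟨fun i => Fin.castLEOrderEmb ((Finset.le_sup (Finset.mem_univ i)).trans hn),
        fun x hx => absurd hx (hz x)⟩ hE
    rw [Nat.le_zero.1 this]
    simp
  exact not_isLittleO_zero (hM.isLittleO.trans_isBigO h0)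

/-- No layer of a minimal matrix is empty. -/
theorem exists_entry_last (hM : M.IsMinimallyNonO) (c : Fin (M.side (Fin.last m))) :
    ∃ x, M.entry x = true ∧ x (Fin.last m) = c := by
  classical
  by_contra! hc
  obtain ⟨x₀, hx₀⟩ := hM.exists_entry
  let J : ℕ := M.side (Fin.last m)
  have hJ0 : 0 < J := M.side_pos _
  let U : ∀ i, Finset (Fin (M.side i)) := fun i => Finset.univ.filter fun c =>
    i ≠ Fin.last m ∨ ∃ x, M.entry x = true ∧ x i = c
  have hU : ∀ i, (U i).Nonempty := fun i =>
    ⟨x₀ i, Finset.mem_filter.2 ⟨Finset.mem_univ _, Or.inr ⟨x₀, hx₀, rfl⟩⟩⟩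
  set Q := M.submatrix U hU
  have hne : Q ≠ M := by
    intro h
    have h' : (U (Fin.last m)).card = M.side (Fin.last m) :=
      congrFun (congrArg ZeroOneMatrix.side h) (Fin.last m)
    have h'' := (Finset.card_eq_iff_eq_univ _).1 (h'.trans (Fintype.card_fin _).symm)
    have : c ∈ U (Fin.last m) := h'' ▸ Finset.mem_univ c
    rcases (Finset.mem_filter.1 this).2 with h | ⟨x, hx, hxc⟩
    · exact h rfl
    · exact hc x hx hxc
  -- Apart from at most `2 * J` boundary layers, `E` splits by the residue of the last coordinate
  -- modulo `J`. A copy of `Q` in one class has gaps wide enough for the empty layers of `M`, so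
  -- each class avoids `Q`.
  refine hM.false_of_le (M.contains_submatrix U hU) hne J (2 * J + 1) (2 * J)
    fun n hn E hE => ?_
  let S : Finset (Fin n) := Finset.univ.filter fun c => (c : ℕ) < J ∨ n ≤ c + J
  have hS : S.card ≤ 2 * J := by
    rw [← Finset.card_range (2 * J)]
    refine Finset.card_le_card_of_injOn
      (fun c => if (c : ℕ) < J then (c : ℕ) else c + 2 * J - n) ?_ ?_
    · intro c hc
      have hc' := (Finset.mem_filter.1 hc).2
      have := c.2
      simp only [Finset.coe_range, Set.mem_Iio]
      split_ifs <;> omega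
    · intro c hc c' hc' h
      have h₁ := (Finset.mem_filter.1 hc).2
      have h₂ := (Finset.mem_filter.1 hc').2
      have := c.2
      have := c'.2
      simp only at h
      apply Fin.ext
      split_ifs at h <;> omega
  let D : ℕ → Finset (Fin (m + 1) → Fin n) := fun r => E.filter fun x =>
    J ≤ (x (Fin.last m) : ℕ) ∧ (x (Fin.last m) : ℕ) + J < n ∧ (x (Fin.last m) : ℕ) % J = r
  have hD : ∀ r, (D r).card ≤ ex n Q := by
    intro r
    refine card_le_ex (by omega) ?_
    rintro ⟨(g : ∀ i, Fin (U i).card ↪o Fin n), hg⟩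
    have hext : ∀ i, ∃ h : Fin (M.side i) ↪o Fin n,
        ∀ y, h ((U i).orderEmbOfFin rfl y) = g i y := by
      intro i
      by_cases hi : i = Fin.last m
      · subst hi
        refine exists_orderEmbedding_extend (r := r) (Q.side_pos _) _ _ fun y => ?_
        have hy := (U (Fin.last m)).orderEmbOfFin_mem rfl y
        rcases (Finset.mem_filter.1 hy).2 with h | ⟨x, hx, hxc⟩
        · exact absurd rfl h
        · have hx' : ∀ i, ∃ z, (U i).orderEmbOfFin rfl z = x i := by
            intro i
            have : x i ∈ Set.range ((U i).orderEmbOfFin rfl) := by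
              rw [Finset.range_orderEmbOfFin]
              exact Finset.mem_filter.2 ⟨Finset.mem_univ _, Or.inr ⟨x, hx, rfl⟩⟩
            exact this
          choose z hz using hx'
          have hzx : Q.entry z = true := by
            change M.entry (fun i => (U i).orderEmbOfFin rfl (z i)) = true
            rw [funext hz]; exact hx
          have hzy : z (Fin.last m) = y :=
            ((U (Fin.last m)).orderEmbOfFin rfl).injective ((hz _).trans hxc)
          have := (Finset.mem_filter.1 (hg z hzx)).2
          rw [← hzy]
          exact this
      · have hsurj : Function.Surjective ((U i).orderEmbOfFin rfl) := by
          rw [← Set.range_eq_univ, Finset.range_orderEmbOfFin]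
          ext c
          simp [U, hi]
        let e := RelIso.ofSurjective _ hsurj
        exact ⟨e.symm.toRelEmbedding.trans (g i), fun y =>
          congrArg (g i) (e.symm_apply_apply y)⟩
    choose h hh using hext
    refine hE ⟨h, fun x hx => ?_⟩
    have hx' : ∀ i, ∃ z, (U i).orderEmbOfFin rfl z = x i := by
      intro i
      have : x i ∈ Set.range ((U i).orderEmbOfFin rfl) := by
        rw [Finset.range_orderEmbOfFin]
        exact Finset.mem_filter.2 ⟨Finset.mem_univ _, Or.inr ⟨x, hx, rfl⟩⟩
      exact this
    choose z hz using hx'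
    have hzx : Q.entry z = true := by
      change M.entry (fun i => (U i).orderEmbOfFin rfl (z i)) = true
      rw [funext hz]; exact hx
    have := (Finset.mem_filter.1 (hg z hzx)).1
    convert this using 2 with i
    rw [← hz, hh]
    rfl
  have hcov : E ⊆ ((Finset.range J).biUnion D) ∪
      (Finset.univ.filter fun x : Fin (m + 1) → Fin n => x (Fin.last m) ∈ S) := by
    intro x hx
    by_cases hxS : x (Fin.last m) ∈ S
    · exact Finset.mem_union_right _ (Finset.mem_filter.2 ⟨Finset.mem_univ _, hxS⟩)
    · refine Finset.mem_union_left _ (Finset.mem_biUnion.2 ⟨(x (Fin.last m) : ℕ) % J,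
        Finset.mem_range.2 (Nat.mod_lt _ hJ0), Finset.mem_filter.2 ⟨hx, ?_⟩⟩)
      simp only [S, Finset.mem_filter, Finset.mem_univ, true_and, not_or, not_lt, not_le] at hxS
      exact ⟨hxS.1, hxS.2, rfl⟩
  calc E.card ≤ _ := Finset.card_le_card hcov
    _ ≤ _ := Finset.card_union_le _ _
    _ ≤ ∑ r ∈ Finset.range J, ex n Q + S.card * n ^ m := add_le_add
        (Finset.card_biUnion_le.trans (Finset.sum_le_sum fun r _ => hD r))
        (card_filter_last_le S)
    _ ≤ _ := by
      rw [Finset.sum_const, Finset.card_range, smul_eq_mul]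
      exact Nat.add_le_add_left (Nat.mul_le_mul_right _ (by omega)) _

/-- An embedding of `M` without its only one in some layer extends to this one. -/
theorem containedIn_of_erase {n : ℕ} {E : Finset (Fin (m + 1) → Fin n)}
    (f : ∀ i, Fin (M.side i) ↪o Fin n) (x : ∀ i, Fin (M.side i))
    (hx : ∀ y, M.entry y = true → y (Fin.last m) = x (Fin.last m) → y = x)
    (hf : ∀ y, M.entry y = true → y ≠ x → (fun i => f i (y i)) ∈ E)
    (z : Fin (m + 1) → Fin n) (hz : z ∈ E) (hzf : ∀ i : Fin m, z i.castSucc = f _ (x i.castSucc))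
    (h₁ : ∀ c < x (Fin.last m), f _ c < z (Fin.last m))
    (h₂ : ∀ c > x (Fin.last m), z (Fin.last m) < f _ c) : M.ContainedIn E := by
  obtain ⟨h, hh, hh'⟩ := exists_orderEmbedding_update (f (Fin.last m)) _ _ h₁ h₂
  refine ⟨Function.update f (Fin.last m) h, fun y hy => ?_⟩
  by_cases hyx : y = x
  · subst hyx
    convert hz using 1
    ext i
    refine Fin.lastCases ?_ (fun i => ?_) i
    · simp [hh]
    · simp [hzf]
  · convert hf y hy hyx using 2 with i
    refine Fin.lastCases ?_ (fun i => ?_) i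
    · simp [hh' _ fun hc => hyx (hx y hy hc)]
    · simp

/-- The only one in a layer is not both preceded and followed by a one in its line. -/
theorem not_between (hM : M.IsMinimallyNonO) {x x₁ x₂ : ∀ i, Fin (M.side i)}
    (h : M.entry x = true) (h₁ : M.entry x₁ = true) (h₂ : M.entry x₂ = true)
    (hx : ∀ y, M.entry y = true → y (Fin.last m) = x (Fin.last m) → y = x)
    (hl₁ : ∀ i : Fin m, x₁ i.castSucc = x i.castSucc)
    (hl₂ : ∀ i : Fin m, x₂ i.castSucc = x i.castSucc)
    (hc₁ : (x₁ (Fin.last m) : ℕ) + 1 = x (Fin.last m))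
    (hc₂ : (x (Fin.last m) : ℕ) + 1 = x₂ (Fin.last m)) : False := by
  classical
  refine hM.false_of_le (M.contains_erase x) (M.erase_ne h)
    2 0 0 fun n hn E hE => ?_
  -- Split `E` by the parity of the rank on the line. Two ones of one class on a line have another
  -- one of `E` between them, which can serve as the image of `x`.
  let rank : (Fin (m + 1) → Fin n) → ℕ := fun y =>
    (E.filter fun z => Fin.init z = Fin.init y ∧ z (Fin.last m) < y (Fin.last m)).card
  have hD : ∀ r, (E.filter fun y => rank y % 2 = r).card ≤ ex n (M.erase x) := by
    intro r
    refine card_le_ex hn ?_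
    rintro ⟨(f : ∀ i, Fin (M.side i) ↪o Fin n), hf⟩
    have hf' : ∀ y, M.entry y = true → y ≠ x → (fun i => f i (y i)) ∈
        E.filter fun y => rank y % 2 = r := fun y hy hyx =>
      hf y (Bool.and_eq_true_iff.2 ⟨hy, decide_eq_true hyx⟩)
    set y₁ : Fin (m + 1) → Fin n := fun i => f i (x₁ i) with hy₁
    set y₂ : Fin (m + 1) → Fin n := fun i => f i (x₂ i) with hy₂
    have m₁ := Finset.mem_filter.1 (hf' x₁ h₁ (by rintro rfl; omega))
    have m₂ := Finset.mem_filter.1 (hf' x₂ h₂ (by rintro rfl; omega))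
    have hinit : Fin.init y₁ = Fin.init y₂ := by
      funext i
      simp only [Fin.init, hy₁, hy₂, hl₁, hl₂]
    have hlt : y₁ (Fin.last m) < y₂ (Fin.last m) :=
      (f _).lt_iff_lt.2 (by rw [Fin.lt_def]; omega)
    obtain ⟨z, hzE, hzi, hz₁, hz₂⟩ : ∃ z ∈ E, Fin.init z = Fin.init y₁ ∧
        y₁ (Fin.last m) < z (Fin.last m) ∧ z (Fin.last m) < y₂ (Fin.last m) := by
      by_contra! hno
      have hr : rank y₂ = rank y₁ + 1 := by
        have : (E.filter fun z => Fin.init z = Fin.init y₂ ∧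
            z (Fin.last m) < y₂ (Fin.last m)) = insert y₁ (E.filter fun z =>
            Fin.init z = Fin.init y₁ ∧ z (Fin.last m) < y₁ (Fin.last m)) := by
          ext z
          simp only [Finset.mem_filter, Finset.mem_insert]
          constructor
          · rintro ⟨hzE, hzi, hzl⟩
            rw [← hinit] at hzi
            rcases lt_trichotomy (z (Fin.last m)) (y₁ (Fin.last m)) with hlz | hlz | hlz
            · exact Or.inr ⟨hzE, hzi, hlz⟩
            · left
              rw [← Fin.snoc_init_self z, hzi, hlz, Fin.snoc_init_self]
            · exact absurd hzl (hno z hzE hzi hlz).not_gt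
          · rintro (rfl | ⟨hzE, hzi, hzl⟩)
            · exact ⟨m₁.1, hinit, hlt⟩
            · exact ⟨hzE, hzi.trans hinit, hzl.trans hlt⟩
        simp only [rank]
        rw [this, Finset.card_insert_of_notMem]
        simp
      have e₁ : rank y₁ % 2 = r := m₁.2
      have e₂ : rank y₂ % 2 = r := m₂.2
      omega
    refine hE (containedIn_of_erase f x hx
      (fun y hy hyx => (Finset.mem_filter.1 (hf' y hy hyx)).1) z hzE ?_ ?_ ?_)
    · intro i
      have := congrFun hzi i
      simp only [Fin.init, hy₁, hl₁] at this
      exact this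
    · intro c hc
      refine lt_of_le_of_lt ((f _).le_iff_le.2 ?_) hz₁
      rw [Fin.lt_def] at hc
      rw [Fin.le_def]
      omega
    · intro c hc
      refine lt_of_lt_of_le hz₂ ((f _).le_iff_le.2 ?_)
      rw [gt_iff_lt, Fin.lt_def] at hc
      rw [Fin.le_def]
      omega
  have hcov : E = (E.filter fun y => rank y % 2 = 0) ∪ (E.filter fun y => rank y % 2 = 1) := by
    rw [← Finset.filter_or, Finset.filter_true_of_mem]
    intro y _
    omega
  rw [hcov]
  refine (Finset.card_union_le _ _).trans ?_
  have := hD 0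
  have := hD 1
  omega

/-- If the last layer has only one one, then it is not preceded by a one in its line. -/
theorem not_last (hM : M.IsMinimallyNonO) {x x₁ : ∀ i, Fin (M.side i)}
    (h : M.entry x = true) (h₁ : M.entry x₁ = true)
    (hx : ∀ y, M.entry y = true → y (Fin.last m) = x (Fin.last m) → y = x)
    (hl₁ : ∀ i : Fin m, x₁ i.castSucc = x i.castSucc)
    (hc₁ : (x₁ (Fin.last m) : ℕ) + 1 = x (Fin.last m))
    (hc₂ : (x (Fin.last m) : ℕ) + 1 = M.side (Fin.last m)) : False := by
  classical
  refine hM.false_of_le (M.contains_erase x) (M.erase_ne h)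
    1 1 0 fun n hn E hE => ?_
  -- Discarding the last one of each line costs at most `n ^ m`; any remaining one is followed by a
  -- one of `E` that can serve as the image of `x`.
  let p : (Fin (m + 1) → Fin n) → Prop := fun y => ∃ z ∈ E, Fin.init z = Fin.init y ∧
    y (Fin.last m) < z (Fin.last m)
  have hD : (E.filter p).card ≤ ex n (M.erase x) := by
    refine card_le_ex hn ?_
    rintro ⟨(f : ∀ i, Fin (M.side i) ↪o Fin n), hf⟩
    have hf' : ∀ y, M.entry y = true → y ≠ x → (fun i => f i (y i)) ∈ E.filter p :=
      fun y hy hyx => hf y (Bool.and_eq_true_iff.2 ⟨hy, decide_eq_true hyx⟩)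
    obtain ⟨-, z, hzE, hzi, hz₁⟩ := Finset.mem_filter.1 (hf' x₁ h₁ (by rintro rfl; omega))
    refine hE (containedIn_of_erase f x hx
      (fun y hy hyx => (Finset.mem_filter.1 (hf' y hy hyx)).1) z hzE ?_ ?_ ?_)
    · intro i
      have := congrFun hzi i
      simp only [Fin.init, hl₁] at this
      exact this
    · intro c hc
      refine lt_of_le_of_lt ((f _).le_iff_le.2 ?_) hz₁
      rw [Fin.lt_def] at hc
      rw [Fin.le_def]
      omega
    · intro c hc
      rw [gt_iff_lt, Fin.lt_def] at hc
      omega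
  have hN : (E.filter fun y => ¬ p y).card ≤ n ^ m := by
    calc _ ≤ (Finset.univ : Finset (Fin m → Fin n)).card := by
          refine Finset.card_le_card_of_injOn Fin.init (fun _ _ => Finset.mem_univ _) ?_
          intro y hy z hz hyz
          have hy' := Finset.mem_filter.1 hy
          have hz' := Finset.mem_filter.1 hz
          rcases lt_trichotomy (y (Fin.last m)) (z (Fin.last m)) with hl | hl | hl
          · exact absurd ⟨z, hz'.1, hyz.symm, hl⟩ hy'.2
          · rw [← Fin.snoc_init_self z, ← hyz, ← hl, Fin.snoc_init_self]
          · exact absurd ⟨y, hy'.1, hyz, hl⟩ hz'.2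
      _ = n ^ m := by simp
  rw [← Finset.card_filter_add_card_filter_not (s := E) p]
  omega

end IsMinimallyNonO

end ZeroOneMatrix

/-! ### The number of layers. -/

/-- A sequence of `k` letters without an alternation `a b a b` changes at most `2 * k - 2` times. -/
theorem card_changes_le {k : ℕ} (v : ℕ → Fin k) (t : ℕ)
    (h : ∀ c₁ c₂ c₃ c₄, c₁ < c₂ → c₂ < c₃ → c₃ < c₄ → c₄ ≤ t → v c₁ = v c₃ → v c₂ = v c₄ →
      v c₁ = v c₂) :
    ((Finset.range t).filter fun c => v (c + 1) ≠ v c).card ≤ 2 * k - 2 := by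
  classical
  -- At a change either the old letter occurs for the last time or the new one for the first time;
  -- otherwise an earlier new letter and a later old one complete an alternation. The final letter
  -- is never left for good and the initial one is never new, hence `k - 1` twice.
  let A := (Finset.range t).filter fun c => ∀ c' > c, c' ≤ t → v c' ≠ v c
  let B := (Finset.range t).filter fun c => ∀ c' ≤ c, v c' ≠ v (c + 1)
  have hA : A.card ≤ k - 1 := by
    calc A.card ≤ (Finset.univ.erase (v t)).card := by
          refine Finset.card_le_card_of_injOn v ?_ ?_
          · intro c hc
            obtain ⟨h₁, h₂⟩ := Finset.mem_filter.1 hc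
            simpa using (h₂ t (Finset.mem_range.1 h₁) le_rfl).symm
          · intro c hc c' hc' hv
            obtain ⟨h₁, h₂⟩ := Finset.mem_filter.1 hc
            obtain ⟨h₁', h₂'⟩ := Finset.mem_filter.1 hc'
            rcases lt_trichotomy c c' with hl | hl | hl
            · exact absurd hv.symm (h₂ c' hl (Finset.mem_range.1 h₁').le)
            · exact hl
            · exact absurd hv (h₂' c hl (Finset.mem_range.1 h₁).le)
      _ = k - 1 := by simp
  have hB : B.card ≤ k - 1 := by
    calc B.card ≤ (Finset.univ.erase (v 0)).card := by
          refine Finset.card_le_card_of_injOn (fun c => v (c + 1)) ?_ ?_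
          · intro c hc
            obtain ⟨h₁, h₂⟩ := Finset.mem_filter.1 hc
            simpa using (h₂ 0 (Nat.zero_le c)).symm
          · intro c hc c' hc' hv
            obtain ⟨h₁, h₂⟩ := Finset.mem_filter.1 hc
            obtain ⟨h₁', h₂'⟩ := Finset.mem_filter.1 hc'
            rcases lt_trichotomy c c' with hl | hl | hl
            · exact absurd hv (h₂' (c + 1) hl)
            · exact hl
            · exact absurd hv.symm (h₂ (c' + 1) hl)
      _ = k - 1 := by simp
  have hAB : ((Finset.range t).filter fun c => v (c + 1) ≠ v c) ⊆ A ∪ B := by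
    intro c hc
    obtain ⟨h₁, h₂⟩ := Finset.mem_filter.1 hc
    by_contra hn
    simp only [A, B, Finset.mem_union, Finset.mem_filter, h₁, true_and, not_or] at hn
    push Not at hn
    obtain ⟨⟨c₄, l₄, l₄', e₄⟩, c₁, l₁, e₁⟩ := hn
    have h₃ : c₁ ≠ c := by rintro rfl; exact h₂ e₁.symm
    have h₄ : c₄ ≠ c + 1 := by rintro rfl; exact h₂ e₄
    have := h c₁ c (c + 1) c₄ (by omega) (by omega) (by omega) l₄' e₁ e₄.symm
    exact h₂ (e₁.symm.trans this)
  have := (Finset.card_le_card hAB).trans (Finset.card_union_le _ _)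
  omega

/-- A greedy choice, used to pick a one in each layer that leaves the previous line if possible. A
stay then shows that the layer has no other one. -/
theorem exists_seq_preferring {α : Type*} (X : ℕ → Set α) (hX : ∀ c, (X c).Nonempty)
    (r : α → α → Prop) :
    ∃ u : ℕ → α, (∀ c, u c ∈ X c) ∧ ∀ c, (∃ y ∈ X (c + 1), r (u c) y) → r (u c) (u (c + 1)) := by
  have h : ∀ c a, ∃ b ∈ X (c + 1), (∃ y ∈ X (c + 1), r a y) → r a b := by
    intro c a
    by_cases hy : ∃ y ∈ X (c + 1), r a y
    · obtain ⟨y, hy, hr⟩ := hy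
      exact ⟨y, hy, fun _ => hr⟩
    · exact ⟨(hX (c + 1)).some, (hX (c + 1)).some_mem, fun h => absurd h hy⟩
  choose g hg hr using h
  let u : ℕ → α := fun c => Nat.rec (hX 0).some g c
  refine ⟨u, fun c => ?_, fun c => hr c (u c)⟩
  cases c with
  | zero => exact (hX 0).some_mem
  | succ c => exact hg c (u c)

namespace ZeroOneMatrix.IsMinimallyNonO

variable {m : ℕ} {M : ZeroOneMatrix (m + 1)}

theorem ones_of_alternation (hM : M.IsMinimallyNonO) (i : Fin m)
    (x₁ x₂ x₃ x₄ : ∀ j, Fin (M.side j)) (h₁ : M.entry x₁ = true) (h₂ : M.entry x₂ = true)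
    (h₃ : M.entry x₃ = true) (h₄ : M.entry x₄ = true)
    (h₁₃ : x₁ i.castSucc = x₃ i.castSucc) (h₂₄ : x₂ i.castSucc = x₄ i.castSucc)
    (hne : x₁ i.castSucc ≠ x₂ i.castSucc) (l₁ : x₁ (Fin.last m) < x₂ (Fin.last m))
    (l₂ : x₂ (Fin.last m) < x₃ (Fin.last m)) (l₃ : x₃ (Fin.last m) < x₄ (Fin.last m))
    (x : ∀ j, Fin (M.side j)) (hx : M.entry x = true) : x = x₁ ∨ x = x₂ ∨ x = x₃ ∨ x = x₄ := by
  have he := hM.entry_eq_of_isLittleO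
    (e := fun x => decide (x = x₁ ∨ x = x₂ ∨ x = x₃ ∨ x = x₄)) ?_ ?_
  · rw [← he] at hx
    exact of_decide_eq_true hx
  · intro x hx
    rcases of_decide_eq_true hx with rfl | rfl | rfl | rfl <;> assumption
  · exact isLittleO_ex_of_alternation _ i x₁ x₂ x₃ x₄ (by simp [withEntry]) (by simp [withEntry])
      (by simp [withEntry]) (by simp [withEntry]) h₁₃ h₂₄ hne l₁ l₂ l₃

theorem ones_of_furedi (hM : M.IsMinimallyNonO) (i : Fin m)
    (x₁ x₂ x₃ x₄ : ∀ j, Fin (M.side j)) (h₁ : M.entry x₁ = true) (h₂ : M.entry x₂ = true)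
    (h₃ : M.entry x₃ = true) (h₄ : M.entry x₄ = true)
    (h₂₃ : x₂ i.castSucc = x₃ i.castSucc) (h₁₄ : x₁ i.castSucc = x₄ i.castSucc)
    (hne : x₁ i.castSucc ≠ x₂ i.castSucc) (l₁ : x₁ (Fin.last m) ≤ x₂ (Fin.last m))
    (l₂ : x₂ (Fin.last m) < x₃ (Fin.last m)) (l₃ : x₃ (Fin.last m) = x₄ (Fin.last m))
    (x : ∀ j, Fin (M.side j)) (hx : M.entry x = true) : x = x₁ ∨ x = x₂ ∨ x = x₃ ∨ x = x₄ := by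
  have he := hM.entry_eq_of_isLittleO
    (e := fun x => decide (x = x₁ ∨ x = x₂ ∨ x = x₃ ∨ x = x₄)) ?_ ?_
  · rw [← he] at hx
    exact of_decide_eq_true hx
  · intro x hx
    rcases of_decide_eq_true hx with rfl | rfl | rfl | rfl <;> assumption
  · exact isLittleO_ex_of_furedi _ i x₁ x₂ x₃ x₄ (by simp [withEntry]) (by simp [withEntry])
      (by simp [withEntry]) (by simp [withEntry]) h₂₃ h₁₄ hne l₁ l₂ l₃

/-- Makes room for the exceptional matrices: those with an alternation have at most four layers, and
those of Füredi's type use codes with `j = 3`. -/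
theorem five_le (M : ZeroOneMatrix (m + 1)) (i : Fin m) {a b : Fin (M.side i.castSucc)}
    (h : a ≠ b) : 5 ≤ 1 + 2 * ∑ i : Fin m, (2 * M.side i.castSucc - 2) := by
  have h₁ := Finset.single_le_sum (f := fun i : Fin m => 2 * M.side i.castSucc - 2)
    (fun _ _ => Nat.zero_le _) (Finset.mem_univ i)
  have h₂ : (a : ℕ) ≠ b := fun h' => h (Fin.ext h')
  have := a.2
  have := b.2
  omega

theorem side_last_le (hM : M.IsMinimallyNonO) :
    M.side (Fin.last m) ≤ 1 + 2 * ∑ i : Fin m, (2 * M.side i.castSucc - 2) := by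
  classical
  by_cases halt : ∃ (i : Fin m) (x₁ x₂ x₃ x₄ : ∀ j, Fin (M.side j)), M.entry x₁ = true ∧
      M.entry x₂ = true ∧ M.entry x₃ = true ∧ M.entry x₄ = true ∧
      x₁ i.castSucc = x₃ i.castSucc ∧ x₂ i.castSucc = x₄ i.castSucc ∧
      x₁ i.castSucc ≠ x₂ i.castSucc ∧ x₁ (Fin.last m) < x₂ (Fin.last m) ∧
      x₂ (Fin.last m) < x₃ (Fin.last m) ∧ x₃ (Fin.last m) < x₄ (Fin.last m)
  · obtain ⟨i, x₁, x₂, x₃, x₄, h₁, h₂, h₃, h₄, h₁₃, h₂₄, hne, l₁, l₂, l₃⟩ := halt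
    have hx := hM.ones_of_alternation i x₁ x₂ x₃ x₄ h₁ h₂ h₃ h₄ h₁₃ h₂₄ hne l₁ l₂ l₃
    have h4 : M.side (Fin.last m) ≤ 4 := by
      calc M.side (Fin.last m) = (Finset.univ : Finset (Fin (M.side (Fin.last m)))).card := by simp
        _ ≤ (({x₁, x₂, x₃, x₄} : Finset (∀ j, Fin (M.side j))).image
            fun x => x (Fin.last m)).card := by
          refine Finset.card_le_card fun c _ => ?_
          obtain ⟨x, hx', hxc⟩ := hM.exists_entry_last c
          exact Finset.mem_image.2 ⟨x, by simpa using hx x hx', hxc⟩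
        _ ≤ _ := Finset.card_image_le
        _ ≤ 4 := Finset.card_le_four
    have := five_le M i hne
    omega
  -- Beyond the last layer the condition is vacuous, so that the sequence is defined on all of `ℕ`.
  · let X : ℕ → Set (∀ j, Fin (M.side j)) := fun c => {x | c < M.side (Fin.last m) →
      M.entry x = true ∧ (x (Fin.last m) : ℕ) = c}
    have hX : ∀ c, (X c).Nonempty := by
      intro c
      by_cases hc : c < M.side (Fin.last m)
      · obtain ⟨x, hx, hxc⟩ := hM.exists_entry_last ⟨c, hc⟩
        exact ⟨x, fun _ => ⟨hx, by rw [hxc]⟩⟩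
      · obtain ⟨x, -⟩ := hM.exists_entry
        exact ⟨x, fun h => absurd h hc⟩
    obtain ⟨u, huX, hu⟩ := exists_seq_preferring X hX
      (fun x y => ¬ ∀ i : Fin m, y i.castSucc = x i.castSucc)
    obtain ⟨t, ht⟩ : ∃ t, M.side (Fin.last m) = t + 1 :=
      ⟨M.side (Fin.last m) - 1, by have := M.side_pos (Fin.last m); omega⟩
    have hu1 : ∀ c ≤ t, M.entry (u c) = true := fun c hc => (huX c (by omega)).1
    have hu2 : ∀ c ≤ t, (u c (Fin.last m) : ℕ) = c := fun c hc => (huX c (by omega)).2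
    have huniq : ∀ c < t, (∀ i : Fin m, u (c + 1) i.castSucc = u c i.castSucc) →
        ∀ y, M.entry y = true → y (Fin.last m) = u (c + 1) (Fin.last m) → y = u (c + 1) := by
      intro c hc hs y hy hyc
      have hy' : ∀ i : Fin m, y i.castSucc = u c i.castSucc := by
        by_contra hne
        exact hu c ⟨y, fun _ => ⟨hy, by rw [hyc, hu2 _ hc]⟩, hne⟩ hs
      funext i
      refine Fin.lastCases hyc (fun i => ?_) i
      rw [hy', hs]
    let same : ℕ → Prop := fun c => ∀ i : Fin m, u (c + 1) i.castSucc = u c i.castSucc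
    -- Shifting by one injects stays into changes: a stay cannot be the final step by `not_last`,
    -- nor be followed by another stay by `not_between`.
    have hN : ((Finset.range t).filter same).card ≤
        ((Finset.range t).filter fun c => ¬ same c).card := by
      refine Finset.card_le_card_of_injOn (fun c => c + 1) ?_ (fun a _ b _ h => Nat.succ.inj h)
      intro c hc
      obtain ⟨hct, hs⟩ := Finset.mem_filter.1 hc
      rw [Finset.mem_range] at hct
      have e₁ := hu2 c hct.le
      have e₂ := hu2 (c + 1) hct
      have hct' : c + 1 < t := by
        by_contra hlt
        exact hM.not_last (hu1 (c + 1) hct) (hu1 c hct.le) (huniq c hct hs) (fun i => (hs i).symm)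
          (by omega) (by omega)
      refine Finset.mem_coe.2 (Finset.mem_filter.2 ⟨Finset.mem_range.2 hct', fun hs' => ?_⟩)
      have e₃ := hu2 (c + 1 + 1) hct'
      exact hM.not_between (hu1 (c + 1) hct) (hu1 c hct.le) (hu1 (c + 1 + 1) hct') (huniq c hct hs)
        (fun i => (hs i).symm) hs' (by omega) (by omega)
    have hC : ((Finset.range t).filter fun c => ¬ same c).card ≤
        ∑ i : Fin m, (2 * M.side i.castSucc - 2) := by
      calc _ ≤ (Finset.univ.biUnion fun i : Fin m => (Finset.range t).filter fun c =>
            u (c + 1) i.castSucc ≠ u c i.castSucc).card := by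
            refine Finset.card_le_card fun c hc => ?_
            obtain ⟨hct, hs⟩ := Finset.mem_filter.1 hc
            obtain ⟨i, hi⟩ := not_forall.1 hs
            exact Finset.mem_biUnion.2 ⟨i, Finset.mem_univ _, Finset.mem_filter.2 ⟨hct, hi⟩⟩
        _ ≤ _ := Finset.card_biUnion_le
        _ ≤ _ := Finset.sum_le_sum fun i _ => by
          refine card_changes_le (fun c => u c i.castSucc) t ?_
          intro c₁ c₂ c₃ c₄ l₁ l₂ l₃ l₄ e₁ e₂
          by_contra hne
          have f₁ := hu2 c₁ (by omega)
          have f₂ := hu2 c₂ (by omega)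
          have f₃ := hu2 c₃ (by omega)
          have f₄ := hu2 c₄ (by omega)
          exact halt ⟨i, u c₁, u c₂, u c₃, u c₄, hu1 _ (by omega), hu1 _ (by omega),
            hu1 _ (by omega), hu1 _ (by omega), e₁, e₂, hne, by rw [Fin.lt_def]; omega,
            by rw [Fin.lt_def]; omega, by rw [Fin.lt_def]; omega⟩
    have hsum := Finset.card_filter_add_card_filter_not (s := Finset.range t) same
    rw [Finset.card_range] at hsum
    omega

end ZeroOneMatrix.IsMinimallyNonO

/-! ### Coding minimal matrices by lines and layers. -/

namespace ZeroOneMatrix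

variable {m : ℕ}

/-- There is a one on the line `l` in the layer `c`. -/
def line (M : ZeroOneMatrix (m + 1)) (l : ∀ i : Fin m, Fin (M.side i.castSucc)) (c : ℕ) : Prop :=
  ∃ h : c < M.side (Fin.last m),
    M.entry (Fin.snoc (α := fun i => Fin (M.side i)) l ⟨c, h⟩) = true

/-- The matrix with `j` layers and ones on the line `l` in the layers `c` such that `ψ l c`. -/
noncomputable def ofLines (k : Fin m → ℕ) (j : ℕ) (ψ : (∀ i, Fin (k i)) → ℕ → Prop) :
    ZeroOneMatrix (m + 1) where
  -- The maximum only secures positivity; for the sides of an actual matrix it changes nothing.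
  side i := max 1 (Fin.snoc (α := fun _ => ℕ) k j i)
  side_pos _ := lt_max_of_lt_left one_pos
  entry x := @decide (∃ l, (∀ i, (l i : ℕ) = x (Fin.castSucc i)) ∧ ψ l (x (Fin.last m)))
    (Classical.propDecidable _)

/-- Entries given through numerical coordinates need no transport along an equality of sides. -/
theorem eq_of_side_eq {d : ℕ} {s : Fin d → ℕ} (hs : ∀ i, 0 < s i) {Ψ : (Fin d → ℕ) → Bool}
    (M : ZeroOneMatrix d) (h : s = M.side) (h' : ∀ x, Ψ (fun i => x i) = M.entry x) :
    (⟨s, hs, fun x => Ψ fun i => x i⟩ : ZeroOneMatrix d) = M := by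
  obtain ⟨s', hs', e⟩ := M
  subst h
  simp only [mk.injEq, heq_eq_eq, true_and]
  exact funext h'

theorem ofLines_eq (M : ZeroOneMatrix (m + 1)) {k : Fin m → ℕ} {j : ℕ}
    {ψ : (∀ i, Fin (k i)) → ℕ → Prop} (hk : k = fun i => M.side i.castSucc)
    (hj : j = M.side (Fin.last m)) (h : ∀ l : ∀ i : Fin m, Fin (M.side i.castSucc),
      ∀ c < M.side (Fin.last m), ψ (fun i => Fin.cast (congrFun hk i).symm (l i)) c ↔ M.line l c) :
    ofLines k j ψ = M := by
  subst hk hj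
  refine eq_of_side_eq (Ψ := fun v => @decide (∃ l : ∀ i : Fin m, Fin (M.side i.castSucc),
    (∀ i, (l i : ℕ) = v (Fin.castSucc i)) ∧ ψ l (v (Fin.last m))) (Classical.propDecidable _))
    _ M ?_ ?_
  · funext i
    have := M.side_pos i
    refine Fin.lastCases ?_ (fun i => ?_) i <;> simp <;> exact M.side_pos _
  · intro x
    rw [Bool.eq_iff_iff]
    refine (@decide_eq_true_iff _ (Classical.propDecidable _)).trans ?_
    have hx : M.entry x = true ↔ M.line (fun i => x i.castSucc) (x (Fin.last m)) := by
      have hs : (Fin.snoc (α := fun i => Fin (M.side i)) (fun i => x i.castSucc)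
        (x (Fin.last m))) = x := Fin.snoc_init_self x
      simp only [line, Fin.eta, hs, Fin.is_lt, exists_true_left]
    rw [hx, ← h _ _ (x (Fin.last m)).2]
    constructor
    · rintro ⟨l, hl, hψ⟩
      obtain rfl : l = fun i : Fin m => x i.castSucc := funext fun i => Fin.ext (hl i)
      exact hψ
    · intro hψ
      exact ⟨_, fun _ => rfl, hψ⟩

/-- A code for a matrix with `j` layers is the position of the first one of each line, with `j`
for an empty line, and a line for each layer but the first: the line which has a one in this layer
that is not its first one.  The codes with `j = 3` where the line chosen for the layer `1` begins
later than in this layer are used for the matrices with just two nonempty lines which both have a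
one in the last layer that is not the first one. -/
noncomputable def decode (k : Fin m → ℕ) (j : ℕ)
    (p : ((∀ i, Fin (k i)) → Fin (j + 1)) × (Fin (j - 1) → ∀ i, Fin (k i))) :
    ZeroOneMatrix (m + 1) :=
  open Classical in
  if h : ∃ h : j = 3, 1 < (p.1 (p.2 ⟨0, by omega⟩) : ℕ) then
    -- Two values exceed `1`: `2` selects the three-layer exception and `3` the two-layer one.
    if (p.1 (p.2 ⟨0, by have := h.1; omega⟩) : ℕ) = 2 then
      ofLines k 3 fun l c => (l = p.2 ⟨1, by have := h.1; omega⟩ ∧ (c = 0 ∨ c = 2)) ∨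
        (l = p.2 ⟨0, by have := h.1; omega⟩ ∧ (c = 1 ∨ c = 2))
    else ofLines k 2 fun l _ => l = p.2 ⟨1, by have := h.1; omega⟩ ∨
      l = p.2 ⟨0, by have := h.1; omega⟩
  else ofLines k j fun l c => (p.1 l : ℕ) = c ∨ ∃ t : Fin (j - 1), (t : ℕ) + 1 = c ∧ p.2 t = l

/-- The codes of the matrices with `j` layers. -/
def codes (k : Fin m → ℕ) (j : ℕ) :
    Finset (((∀ i, Fin (k i)) → Fin (j + 1)) × (Fin (j - 1) → ∀ i, Fin (k i))) :=
  -- The first layer of a minimal matrix is not empty, so some line begins there.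
  (Finset.univ.filter fun f => ∃ l, f l = 0) ×ˢ Finset.univ

theorem card_codes (k : Fin m → ℕ) (j : ℕ) :
    (codes k j).card = ((j + 1) ^ (∏ i, k i) - j ^ (∏ i, k i)) * (∏ i, k i) ^ (j - 1) := by
  classical
  have h₁ : ((Finset.univ : Finset ((∀ i, Fin (k i)) → Fin (j + 1))).filter
      fun f => ¬ ∃ l, f l = 0).card = j ^ (∏ i, k i) := by
    have : ((Finset.univ : Finset ((∀ i, Fin (k i)) → Fin (j + 1))).filter
        fun f => ¬ ∃ l, f l = 0) = Fintype.piFinset fun _ => Finset.univ.erase 0 := by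
      ext f
      simp
    rw [this, Fintype.card_piFinset]
    simp
  have h₂ := Finset.card_filter_add_card_filter_not
    (s := (Finset.univ : Finset ((∀ i, Fin (k i)) → Fin (j + 1)))) fun f => ∃ l, f l = 0
  rw [h₁] at h₂
  have h₃ : (Finset.univ : Finset ((∀ i, Fin (k i)) → Fin (j + 1))).card =
      (j + 1) ^ (∏ i, k i) := by simp
  rw [codes, Finset.card_product, ← h₃, ← h₂, Nat.add_sub_cancel]
  simp

namespace IsMinimallyNonO

variable {M : ZeroOneMatrix (m + 1)}

theorem exists_line (hM : M.IsMinimallyNonO) {c : ℕ} (hc : c < M.side (Fin.last m)) :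
    ∃ l, M.line l c := by
  obtain ⟨x, hx, hxc⟩ := hM.exists_entry_last ⟨c, hc⟩
  refine ⟨fun i => x i.castSucc, hc, ?_⟩
  rw [← hxc]
  have hs : (Fin.snoc (α := fun i => Fin (M.side i)) (fun i => x i.castSucc)
    (x (Fin.last m))) = x := Fin.snoc_init_self x
  rw [hs]
  exact hx

theorem lines_of_furedi (hM : M.IsMinimallyNonO) {l l' : ∀ i : Fin m, Fin (M.side i.castSucc)}
    (hne : l' ≠ l) {c₁ c₂ c : ℕ} (h₁ : M.line l' c₁) (h₂ : M.line l c₂) (h₃ : M.line l c)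
    (h₄ : M.line l' c) (hc : c₁ ≤ c₂) (hc' : c₂ < c) {z t} (h : M.line z t) :
    (z = l' ∧ t = c₁) ∨ (z = l ∧ t = c₂) ∨ (z = l ∧ t = c) ∨ (z = l' ∧ t = c) := by
  obtain ⟨i, hi⟩ := Function.ne_iff.1 hne
  obtain ⟨b₁, h₁⟩ := h₁
  obtain ⟨b₂, h₂⟩ := h₂
  obtain ⟨b₃, h₃⟩ := h₃
  obtain ⟨b₄, h₄⟩ := h₄
  obtain ⟨b, h⟩ := h
  have := hM.ones_of_furedi i _ _ _ _ h₁ h₂ h₃ h₄ (by simp) (by simp) (by simpa using hi)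
    (by simpa using hc) (by simpa using hc') (by simp) _ h
  simpa only [Fin.snoc_inj, Fin.mk.injEq] using this

/-- Two non-first ones in one layer form Füredi's pattern with earlier ones of their lines; then `M`
has just these four ones and two or three layers. Otherwise first ones and one line per later layer
recover `M`. -/
theorem mem_image_decode (hM : M.IsMinimallyNonO) :
    ∃ j ∈ Finset.Icc 1 (1 + 2 * ∑ i : Fin m, (2 * M.side i.castSucc - 2)),
      ∃ p ∈ codes (fun i => M.side i.castSucc) j, decode (fun i => M.side i.castSucc) j p = M := by
  classical
  set J := M.side (Fin.last m)
  have hJ0 : 0 < J := M.side_pos _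
  by_cases hex : ∃ c l l', M.line l c ∧ M.line l' c ∧ l' ≠ l ∧ (∃ c₁ < c, M.line l' c₁) ∧
      ∃ c₂ < c, M.line l c₂
  · obtain ⟨c, l, l', h₁, h₂, hne, ⟨c₁, hc₁, h₃⟩, c₂, hc₂, h₄⟩ := hex
    wlog hc : c₁ ≤ c₂ generalizing c₁ c₂ l l'
    · exact this l' l h₂ h₁ hne.symm c₂ hc₂ h₄ c₁ hc₁ h₃ (le_of_not_ge hc)
    have hz := fun z t => hM.lines_of_furedi hne h₃ h₄ h₁ h₂ hc hc₂ (z := z) (t := t)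
    have ht : ∀ t < J, t = c₁ ∨ t = c₂ ∨ t = c := by
      intro t ht
      obtain ⟨z, hzt⟩ := hM.exists_line ht
      rcases hz z t hzt with h | h | h | h <;> simp [h.2]
    have hcJ : c < J := h₁.1
    obtain ⟨i, hi⟩ := Function.ne_iff.1 hne
    have hS := five_le M i hi
    have g₀ := ht 0
    have g₁ := ht 1
    have g₂ := ht 2
    have g₃ := ht (J - 1)
    by_cases h12 : c₁ = c₂
    · obtain ⟨rfl, rfl, hc1, hJ2⟩ : c₁ = 0 ∧ c₂ = 0 ∧ c = 1 ∧ J = 2 := by omega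
      subst hc1
      refine ⟨3, Finset.mem_Icc.2 ⟨by omega, by omega⟩,
        (fun z => if z = l then 3 else 0, fun t => if t = 0 then l else l'),
        Finset.mem_product.2 ⟨?_, Finset.mem_univ _⟩, ?_⟩
      · exact Finset.mem_filter.2 ⟨Finset.mem_univ _, l', by simp [hne]⟩
      · rw [decode, dif_pos ⟨rfl, by simp⟩, if_neg (by simp)]
        refine ofLines_eq M rfl hJ2.symm fun z t htJ => ?_
        change (z = l' ∨ z = l) ↔ M.line z t
        obtain rfl | rfl : t = 0 ∨ t = 1 := by omega
        · refine ⟨?_, fun h => ?_⟩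
          · rintro (rfl | rfl) <;> assumption
          · rcases hz z 0 h with h | h | h | h <;> simp [h.1]
        · refine ⟨?_, fun h => ?_⟩
          · rintro (rfl | rfl) <;> assumption
          · rcases hz z 1 h with h | h | h | h <;> simp [h.1]
    · obtain ⟨rfl, rfl, hc1, hJ3⟩ : c₁ = 0 ∧ c₂ = 1 ∧ c = 2 ∧ J = 3 := by omega
      subst hc1
      refine ⟨3, Finset.mem_Icc.2 ⟨by omega, by omega⟩,
        (fun z => if z = l then 2 else 0, fun t => if t = 0 then l else l'),
        Finset.mem_product.2 ⟨?_, Finset.mem_univ _⟩, ?_⟩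
      · exact Finset.mem_filter.2 ⟨Finset.mem_univ _, l', by simp [hne]⟩
      · rw [decode, dif_pos ⟨rfl, by simp⟩, if_pos (by simp)]
        refine ofLines_eq M rfl hJ3.symm fun z t htJ => ?_
        change (z = l' ∧ (t = 0 ∨ t = 2) ∨ z = l ∧ (t = 1 ∨ t = 2)) ↔ M.line z t
        refine ⟨?_, fun h => ?_⟩
        · rintro (⟨rfl, rfl | rfl⟩ | ⟨rfl, rfl | rfl⟩) <;> assumption
        · rcases hz z t h with h | h | h | h <;> simp [h.1, h.2]
  · let F : (∀ i : Fin m, Fin (M.side i.castSucc)) → ℕ := fun l => sInf ({c | M.line l c} ∪ {J})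
    have hFmem : ∀ l, M.line l (F l) ∨ F l = J := fun l =>
      Nat.sInf_mem (s := {c | M.line l c} ∪ {J}) ⟨J, Or.inr rfl⟩
    have hFle : ∀ {l c}, M.line l c → F l ≤ c := fun h => Nat.sInf_le (Or.inl h)
    have hFJ : ∀ l, F l ≤ J := fun l => Nat.sInf_le (Or.inr rfl)
    have hFline : ∀ {l}, F l < J → M.line l (F l) := fun {l} h =>
      (hFmem l).resolve_right h.ne
    -- If every one of the layer is the first of its line, any of them is chosen; decoding it again
    -- adds nothing.
    have hchoose : ∀ t : Fin (J - 1), ∃ l, M.line l (t + 1) ∧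
        ∀ l', M.line l' (t + 1) → F l' < t + 1 → l' = l := by
      intro t
      have htJ : (t : ℕ) + 1 < J := by have := t.2; omega
      by_cases h : ∃ l, M.line l (t + 1) ∧ F l < t + 1
      · obtain ⟨l, hl, hFl⟩ := h
        refine ⟨l, hl, fun l' hl' hFl' => ?_⟩
        by_contra hne
        exact hex ⟨t + 1, l, l', hl, hl', hne, ⟨F l', hFl', hFline (by omega)⟩,
          F l, hFl, hFline (by omega)⟩
      · obtain ⟨l, hl⟩ := hM.exists_line htJ
        exact ⟨l, hl, fun l' hl' hFl' => absurd ⟨l', hl', hFl'⟩ h⟩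
    choose g hg hg' using hchoose
    refine ⟨J, Finset.mem_Icc.2 ⟨hJ0, hM.side_last_le⟩,
      (fun l => ⟨F l, Nat.lt_succ_of_le (hFJ l)⟩, g),
      Finset.mem_product.2 ⟨?_, Finset.mem_univ _⟩, ?_⟩
    · obtain ⟨l, hl⟩ := hM.exists_line hJ0
      exact Finset.mem_filter.2 ⟨Finset.mem_univ _, l, Fin.ext (Nat.le_zero.1 (hFle hl))⟩
    · rw [decode, dif_neg]
      · refine ofLines_eq M rfl rfl fun l c hc => ?_
        change (F l = c ∨ ∃ t : Fin (J - 1), (t : ℕ) + 1 = c ∧ g t = l) ↔ M.line l c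
        constructor
        · rintro (rfl | ⟨t, rfl, rfl⟩)
          · exact hFline hc
          · exact hg t
        · intro h
          rcases (hFle h).lt_or_eq with hl | hl
          · right
            refine ⟨⟨c - 1, by omega⟩, by simp only; omega, ?_⟩
            refine (hg' ⟨c - 1, by omega⟩ l ?_ ?_).symm
            · simp only; rwa [Nat.sub_add_cancel (by omega)]
            · simp only; omega
          · exact Or.inl hl
      -- An ordinary code is never read as an exceptional one: the line chosen for layer `1` has a
      -- one there, so it does not begin later.
      · rintro ⟨h3, h⟩
        exact absurd (hFle (hg ⟨0, by omega⟩)) (not_le.2 h)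

end IsMinimallyNonO

end ZeroOneMatrix

theorem mainTheorem6 (d : ℕ) (hd : 1 ≤ d) (k : Fin (d - 1) → ℕ) (hk : ∀ i, 1 ≤ k i) :
    {M : ZeroOneMatrix d | (∀ i : Fin (d - 1), M.side (Fin.castLE (Nat.sub_le d 1) i) = k i) ∧
        M.IsMinimallyNonO}.Finite ∧
      {M : ZeroOneMatrix d | (∀ i : Fin (d - 1), M.side (Fin.castLE (Nat.sub_le d 1) i) = k i) ∧
        M.IsMinimallyNonO}.ncard ≤
        ∑ j ∈ Finset.Icc 1 (1 + 2 * ∑ i, (2 * k i - 2)),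
          ((j + 1) ^ (∏ i, k i) - j ^ (∏ i, k i)) * (∏ i, k i) ^ (j - 1) := by
  classical
  obtain ⟨m, rfl⟩ : ∃ m, d = m + 1 := ⟨d - 1, by omega⟩
  change Fin m → ℕ at k
  have hsub : {M : ZeroOneMatrix (m + 1) |
      (∀ i : Fin m, M.side (Fin.castLE (Nat.sub_le (m + 1) 1) i) = k i) ∧ M.IsMinimallyNonO} ⊆
      ((Finset.Icc 1 (1 + 2 * ∑ i, (2 * k i - 2))).biUnion fun j =>
        (ZeroOneMatrix.codes k j).image (ZeroOneMatrix.decode k j) :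
          Finset (ZeroOneMatrix (m + 1))) := by
    rintro M ⟨hMk, hM⟩
    obtain rfl : (fun i : Fin m => M.side i.castSucc) = k := funext hMk
    obtain ⟨j, hj, p, hp, hpM⟩ := hM.mem_image_decode
    exact Finset.mem_coe.2 (Finset.mem_biUnion.2 ⟨j, hj, Finset.mem_image.2 ⟨p, hp, hpM⟩⟩)
  refine ⟨(Finset.finite_toSet _).subset hsub,
    (Set.ncard_le_ncard hsub (Finset.finite_toSet _)).trans ?_⟩
  rw [Set.ncard_coe_finset]
  refine Finset.card_biUnion_le.trans (Finset.sum_le_sum fun j _ => ?_)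
  exact Finset.card_image_le.trans (ZeroOneMatrix.card_codes k j).le
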